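/- **Setting.** Let $E=\mathbb R^d$ and let $(X_{n,i})_{1\le i\le n,\,n\in\mathbb N}$ be a triangular array of $E$-valued random vectors on a probability space. Let $r_n,\ell_n$ be natural numbers, $m_n:=\lfloor n/r_n\rfloor$, $v_n:=P\{X_{n,1}\neq 0\}$, and $Y_{n,j}:=(X_{n,i})_{(j-1)r_n<i\le jr_n}$ for $1\le j\le m_n$; $Y_n$ denotes $Y_{n,1}$. Equip $E_\cup:=\bigcup_{l}E^l$ with the $\sigma$-field induced by the Borel $\sigma$-fields on the $E^l$; for $y\in E_\cup$ let $y^{(k)}$ be the vector of the first $k$ components of $y$ (and $y^{(k)}=y$ if $y$ has fewer than $k$ components). A *cluster functional* is a measurable function $f:E_\cup\to\mathbb R$ which vanishes at all zero vectors and satisfies $f(0,\dots,0,y_1,\dots,y_l,0,\dots,0)=f(y_1,\dots,y_l)$ for all $(y_1,\ldots,y_l)\in E_\cup$ and arbitrary numbers of leading and trailing zeros. Let $\mathcal F$ be a family of cluster functionals. Let $$\beta_{n,k}:=\sup_{1\le m\le n-k-1}\ \sup_{C}\Big|P^{(X_{n,i})_{i\le m},\,(X_{n,i})_{m+k+1\le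 i\le n}}(C)-\big(P^{(X_{n,i})_{i\le m}}\otimes P^{(X_{n,i})_{m+k+1\le i\le n}}\big)(C)\Big|$$ ($C$ Borel) be the $\beta$-mixing coefficients of the $n$-th row, and let $\Delta_n(f):=f(Y_n)-f\big(Y_n^{(r_n-\ell_n)}\big)$. Assume, as $n\to\infty$: - (B1) every row $(X_{n,i})_{1\le i\le n}$ is strictly stationary, $\ell_n=o(r_n)$, $\ell_n\to\infty$, $r_n=o(n)$, $r_nv_n\to0$ and $nv_n\to\infty$; - (B2) $\beta_{n,\ell_n}\,n/r_n\to0$; - (C1) for all $f\in\mathcal F$, $\Delta_n(f)$ is integrable for all large $n$, $E\big((\Delta_n(f)-E\Delta_n(f))^2\mathbf 1\{|\Delta_n(f)-E\Delta_n(f)|\le\sqrt{nv_n}\}\big)=o(r_nv_n)$, and $P\{|\Delta_n(f)-E\Delta_n(f)|>\sqrt{nv_n}\}=o(r_n/n)$; - (C2) for all $f\in\mathcal F$, $f(Y_n)$ is square integrable for all large $n$, and $E\big((f(Y_n)-Ef(Y_n))^2\mathbf 1\{|f(Y_n)-Ef(Y_n)|>\varepsilon\sqrt{nv_n}\}\big)=o(r_nv_n)$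 for all $\varepsilon>0$; - (C3) there is a function $c:\mathcal F\times\mathcal F\to\mathbb R$ with $\frac1{r_nv_n}\mathrm{Cov}(f(Y_n),g(Y_n))\to c(f,g)$ for all $f,g\in\mathcal F$. Let $\xi_j$, $j\in\mathbb N$, be i.i.d. random variables with $E\xi_j=0$ and $\mathrm{Var}(\xi_j)=1$, independent of $(X_{n,i})_{1\le i\le n,\,n\in\mathbb N}$, and put $$Z_{n,\xi}(f):=\frac1{\sqrt{nv_n}}\sum_{j=1}^{m_n}\xi_j\big(f(Y_{n,j})-Ef(Y_{n,j})\big),\qquad f\in\mathcal F.$$ Let $E_\xi$ denote the conditional expectation given the data $X_{n,1},\dots,X_{n,n}$, computed with a regular conditional distribution. Let $BL_1(\mathbb R^l)$ be the set of all $g:\mathbb R^l\to\mathbb R$ with $\sup_v|g(v)|\le1$ and $|g(v)-g(w)|\le\|v-w\|$ for all $v,w\in\mathbb R^l$, where $\|\cdot\|$ is the maximum norm. **Theorem 2.1.** Under these conditions $c$ is a covariance function, i.e. all matrices $(c(f_i,f_j))_{1\le i,j\le l}$ with $f_1,\dots,f_l\in\mathcal F$ are positive semidefinite, and, if $Z=(Z(f))_{f\in\mathcal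 F}$ is a centred Gaussian process with covariance function $c$, then for all $l$ and all $f_1,\dots,f_l\in\mathcal F$ $$\sup_{g\in BL_1(\mathbb R^l)}\Big|E_\xi\, g\big((Z_{n,\xi}(f_k))_{1\le k\le l}\big)-E\,g\big((Z(f_k))_{1\le k\le l}\big)\Big|\ \longrightarrow\ 0\quad\text{in probability as } n\to\infty.$$ -/

import Mathlib

open MeasureTheory ProbabilityTheory Filter Topology Asymptotics

noncomputable section

namespace ClusterBootstrap

/-- The space `E_∪ = ⋃_l E^l` of vectors of arbitrary length with components in `E = ℝ^d`; as a
`Sigma` type it carries the σ-field induced by the Borel σ-fields on the `E^l`. (The vector of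
length zero is included; every cluster functional vanishes there.) -/
abbrev EUnion (d : ℕ) : Type := Σ l : ℕ, (Fin l → (Fin d → ℝ))

/-- The vector `(0,…,0,y₁,…,y_l,0,…,0)` with `a` zeros in front and `b` zeros behind. -/
def zeroPad {d : ℕ} (a b : ℕ) (y : EUnion d) : EUnion d :=
  ⟨a + y.1 + b, Fin.append (Fin.append (0 : Fin a → (Fin d → ℝ)) y.2) (0 : Fin b → (Fin d → ℝ))⟩

/-- Cluster functionals: measurable, zero at zero vectors, insensitive to zeros added at the
beginning and at the end. -/
structure IsClusterFunctional {d : ℕ} (f : EUnion d → ℝ) : Prop where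
  measurable : Measurable f
  map_zero : ∀ l : ℕ, f ⟨l, 0⟩ = 0
  map_zeroPad : ∀ (a b : ℕ) (y : EUnion d), f (zeroPad a b y) = f y

/-- `x^(k)`: the first `k` components of `x` if there are that many, and `x` itself otherwise. -/
def truncate {d : ℕ} (k : ℕ) (y : EUnion d) : EUnion d :=
  ⟨min k y.1, fun i => y.2 (Fin.castLE (min_le_right k y.1) i)⟩

section Array

variable {Ω : Type*} {d : ℕ}

/-! In a triangular array `X`, the `n`-th row consists of `X n 0, …, X n (n-1)` (the vectors
`X_{n,1}, …, X_{n,n}`); the values `X n i` with `n ≤ i` play no role. Blocks and multipliers are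
likewise numbered from zero. -/

/-- The segment of `k` consecutive elements of row `n` which starts at position `a`. -/
def segment (X : ℕ → ℕ → Ω → (Fin d → ℝ)) (n a k : ℕ) (ω : Ω) : Fin k → (Fin d → ℝ) :=
  fun i => X n (a + i) ω

/-- The block number `j` of length `r n` of the `n`-th row; the generic block `Y_n` is `j = 0`. -/
def block (X : ℕ → ℕ → Ω → (Fin d → ℝ)) (r : ℕ → ℕ) (n j : ℕ) (ω : Ω) : EUnion d :=
  ⟨r n, segment X n (j * r n) (r n) ω⟩

/-- `Δ_n(f) = f(Y_n) - f(Y_n^(r_n - ℓ_n))`. -/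
def blockDiff (X : ℕ → ℕ → Ω → (Fin d → ℝ)) (r ℓ : ℕ → ℕ) (f : EUnion d → ℝ) (n : ℕ) (ω : Ω) :
    ℝ :=
  f (block X r n 0 ω) - f (truncate (r n - ℓ n) (block X r n 0 ω))

variable [MeasurableSpace Ω]

/-- `v_n = P{X_{n,1} ≠ 0}`. -/
def exceedProb (P : Measure Ω) (X : ℕ → ℕ → Ω → (Fin d → ℝ)) (n : ℕ) : ℝ :=
  P.real {ω | X n 0 ω ≠ 0}

/-- Strict stationarity of all rows of the array. -/
def RowwiseStationary (P : Measure Ω) (X : ℕ → ℕ → Ω → (Fin d → ℝ)) : Prop :=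
  ∀ n a k : ℕ, a + k ≤ n → P.map (segment X n a k) = P.map (segment X n 0 k)

/-- The coefficient of absolute regularity `β_{n,k}` of the `n`-th row: the largest total variation
distance between the joint law of a past `(X_{n,1}, …, X_{n,m})` and the future
`(X_{n,m+k+1}, …, X_{n,n})`, and the product of the two laws, over `1 ≤ m ≤ n - k - 1`. -/
def betaCoeff (P : Measure Ω) (X : ℕ → ℕ → Ω → (Fin d → ℝ)) (n k : ℕ) : ℝ :=
  sSup {b : ℝ | ∃ (m : ℕ) (C : Set ((Fin m → (Fin d → ℝ)) × (Fin (n - (m + k)) → (Fin d → ℝ)))),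
    1 ≤ m ∧ m + k + 1 ≤ n ∧ MeasurableSet C ∧
    b = |(P.map fun ω => (segment X n 0 m ω, segment X n (m + k) (n - (m + k)) ω)).real C
      - ((P.map (segment X n 0 m)).prod (P.map (segment X n (m + k) (n - (m + k))))).real C|}

/-- Condition (B1). -/
structure CondB1 (P : Measure Ω) (X : ℕ → ℕ → Ω → (Fin d → ℝ)) (r ℓ : ℕ → ℕ) : Prop where
  stationary : RowwiseStationary P X
  ell_littleO : (fun n : ℕ => (ℓ n : ℝ)) =o[atTop] fun n : ℕ => (r n : ℝ)
  ell_tendsto : Tendsto ℓ atTop atTop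
  r_littleO : (fun n : ℕ => (r n : ℝ)) =o[atTop] fun n : ℕ => (n : ℝ)
  rv_tendsto : Tendsto (fun n : ℕ => (r n : ℝ) * exceedProb P X n) atTop (𝓝 0)
  nv_tendsto : Tendsto (fun n : ℕ => (n : ℝ) * exceedProb P X n) atTop atTop

/-- Condition (B2). -/
def CondB2 (P : Measure Ω) (X : ℕ → ℕ → Ω → (Fin d → ℝ)) (r ℓ : ℕ → ℕ) : Prop :=
  Tendsto (fun n : ℕ => betaCoeff P X n (ℓ n) * (n : ℝ) / (r n : ℝ)) atTop (𝓝 0)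

/-- Condition (C1); the expectation of `Δ_n(f)` is understood to exist (for large `n`). -/
structure CondC1 (P : Measure Ω) (X : ℕ → ℕ → Ω → (Fin d → ℝ)) (r ℓ : ℕ → ℕ)
    (F : Set (EUnion d → ℝ)) : Prop where
  integrable : ∀ f ∈ F, ∀ᶠ n in atTop, Integrable (blockDiff X r ℓ f n) P
  truncated_sq : ∀ f ∈ F,
    (fun n : ℕ => ∫ ω in {ω | |blockDiff X r ℓ f n ω - ∫ ω', blockDiff X r ℓ f n ω' ∂P|
          ≤ √((n : ℝ) * exceedProb P X n)},
        (blockDiff X r ℓ f n ω - ∫ ω', blockDiff X r ℓ f n ω' ∂P) ^ 2 ∂P)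
      =o[atTop] fun n : ℕ => (r n : ℝ) * exceedProb P X n
  tail : ∀ f ∈ F,
    (fun n : ℕ => P.real {ω | √((n : ℝ) * exceedProb P X n)
          < |blockDiff X r ℓ f n ω - ∫ ω', blockDiff X r ℓ f n ω' ∂P|})
      =o[atTop] fun n : ℕ => (r n : ℝ) / (n : ℝ)

/-- Condition (C2); the second moment of `f(Y_n)` is finite for large `n` (equivalently, the mean
of `f(Y_n)` and the expectation in the displayed condition are finite). -/
structure CondC2 (P : Measure Ω) (X : ℕ → ℕ → Ω → (Fin d → ℝ)) (r : ℕ → ℕ)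
    (F : Set (EUnion d → ℝ)) : Prop where
  memLp : ∀ f ∈ F, ∀ᶠ n in atTop, MemLp (fun ω => f (block X r n 0 ω)) 2 P
  lindeberg : ∀ ε : ℝ, 0 < ε → ∀ f ∈ F,
    (fun n : ℕ => ∫ ω in {ω | ε * √((n : ℝ) * exceedProb P X n)
          < |f (block X r n 0 ω) - ∫ ω', f (block X r n 0 ω') ∂P|},
        (f (block X r n 0 ω) - ∫ ω', f (block X r n 0 ω') ∂P) ^ 2 ∂P)
      =o[atTop] fun n : ℕ => (r n : ℝ) * exceedProb P X n

/-- Condition (C3), with limiting covariance function `c` (square integrability of `f(Y_n)` is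
part of (C2)). -/
def CondC3 (P : Measure Ω) (X : ℕ → ℕ → Ω → (Fin d → ℝ)) (r : ℕ → ℕ)
    (F : Set (EUnion d → ℝ)) (c : F → F → ℝ) : Prop :=
  ∀ f g : F, Tendsto
    (fun n : ℕ => 1 / ((r n : ℝ) * exceedProb P X n) *
      cov[fun ω => f.1 (block X r n 0 ω), fun ω => g.1 (block X r n 0 ω); P])
    atTop (𝓝 (c f g))

/-- The multipliers: i.i.d. with mean zero and variance one, and independent of the array
`(X_{n,i})_{1 ≤ i ≤ n, n ∈ ℕ}`. -/
structure IsMultiplier (P : Measure Ω) (X : ℕ → ℕ → Ω → (Fin d → ℝ)) (ξ : ℕ → Ω → ℝ) : Prop where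
  measurable : ∀ j, Measurable (ξ j)
  iIndep : iIndepFun ξ P
  identDistrib : ∀ j, IdentDistrib (ξ j) (ξ 0) P P
  memLp : MemLp (ξ 0) 2 P
  mean_zero : ∫ ω, ξ 0 ω ∂P = 0
  variance_one : Var[ξ 0; P] = 1
  indep_array : IndepFun (fun ω (p : Σ n : ℕ, Fin n) => X p.1 p.2 ω) (fun ω j => ξ j ω) P

/-- The multiplier block bootstrap process
`Z_{n,ξ}(f) = (n v_n)^{-1/2} ∑_{j ≤ m_n} ξ_j (f(Y_{n,j}) - E f(Y_{n,j}))`, `m_n = ⌊n / r_n⌋`. -/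
def multiplierProcess (P : Measure Ω) (X : ℕ → ℕ → Ω → (Fin d → ℝ)) (r : ℕ → ℕ) (ξ : ℕ → Ω → ℝ)
    (n : ℕ) (f : EUnion d → ℝ) (ω : Ω) : ℝ :=
  1 / √((n : ℝ) * exceedProb P X n) * ∑ j ∈ Finset.range (n / r n),
    ξ j ω * (f (block X r n j ω) - ∫ ω', f (block X r n j ω') ∂P)

end Array

/-- `BL₁(ℝ^l)`: functions bounded by one and 1-Lipschitz for the maximum norm (which is the norm of
`Fin l → ℝ`). -/
def BL1 (l : ℕ) : Set ((Fin l → ℝ) → ℝ) :=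
  {g | (∀ v, |g v| ≤ 1) ∧ ∀ v w, |g v - g w| ≤ ‖v - w‖}

/-- The bounded Lipschitz distance of two probability measures on `ℝ^l`. -/
def dBL {l : ℕ} (Q₁ Q₂ : Measure (Fin l → ℝ)) : ℝ :=
  sSup {a : ℝ | ∃ g ∈ BL1 l, a = |∫ v, g v ∂Q₁ - ∫ v, g v ∂Q₂|}

/-- A centred Gaussian process with index set `T` and covariance function `c`. -/
structure IsCentredGaussianProcess {Ω T : Type*} [MeasurableSpace Ω] (P : Measure Ω)
    (Z : T → Ω → ℝ) (c : T → T → ℝ) : Prop where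
  gaussian : IsGaussianProcess Z P
  mean_zero : ∀ t, ∫ ω, Z t ω ∂P = 0
  cov_eq : ∀ s t, cov[Z s, Z t; P] = c s t

end ClusterBootstrap

end

/-! Given the data, the vector of the `Z_{n,ξ}(f_k)` is a sum `∑ j, ξ_j w_{n,j}` of i.i.d.
multipliers with frozen weight vectors, namely the centred block values divided by `√(n v_n)`
(`condDistrib_multiplierProcess`). A central limit theorem for deterministic weights therefore
governs the conditional law: it is close to the Gaussian law with covariance matrix `C = (c(f_k,
f_k'))` as soon as `∑ j, w_{n,j} w_{n,j}ᵀ` is close to `C` and all weights are small. In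
`exists_forall_dBL_weighted_sum_lt` the required tolerance does not depend on the number of weights,
so random weights may be inserted on the event that both conditions hold.

It remains to see that this event has probability tending to one. Smallness of the weights follows
from the Lindeberg condition by a union bound (`tendsto_measureReal_exists_lt_abs_blocks`). The sums
of products reduce by polarization to a weak law for sums of squares of block functions
(`tendsto_measureReal_sum_sq_blocks`). Since squares are nonnegative, their Laplace transform is the
expectation of a product of `[0,1]`-valued block functions. The blocks with even and with odd number
are treated separately: a whole block of length `r_n ≥ ℓ_n` then lies between neighbours, and
β-mixing factorizes the expectation up to an error of order `m_n β_{n,ℓ_n} → 0`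
(`abs_integral_prod_blocks_sub_le`). Each factor is expanded to first order with the help of the
Lindeberg condition, and convergence of Laplace transforms to those of constants gives convergence
in probability.

Positive semidefiniteness of `c` is inherited from the rescaled covariance matrices of which it is
the limit. -/

namespace ClusterBootstrap

/-! ### Weak convergence implies convergence in the bounded Lipschitz distance. -/

section BoundedLipschitz

variable {l : ℕ}

/-- The Lévy–Prokhorov bound compares superlevel sets of `f` under `μ` with their `ε`-thickenings
under `ν`. As `f` is 1-Lipschitz, the thickening of `{t ≤ f}` lies in `{t ≤ f + ε}`, and the
layer-cake formula for `f + ε` turns these back into an integral. -/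
lemma integral_le_integral_add_of_levyProkhorovEDist_lt {E : Type*} [PseudoMetricSpace E]
    [MeasurableSpace E] [OpensMeasurableSpace E] (μ ν : Measure E)
    [IsProbabilityMeasure μ] [IsProbabilityMeasure ν] {ε b : ℝ} (hε : 0 < ε)
    (h : levyProkhorovEDist μ ν < ENNReal.ofReal ε) (f : BoundedContinuousFunction E ℝ)
    (h0 : ∀ x, 0 ≤ f x) (hb : ∀ x, f x ≤ b) (hf : ∀ x y, |f x - f y| ≤ dist x y) :
    ∫ x, f x ∂μ ≤ ∫ x, f x ∂ν + ε * (1 + b) := by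
  have hb0 : 0 ≤ b := by
    obtain ⟨x⟩ := μ.nonempty_of_neZero
    exact (h0 x).trans (hb x)
  have hn : ‖f‖ ≤ b := by
    rw [BoundedContinuousFunction.norm_le hb0]
    intro x
    rw [Real.norm_eq_abs, abs_of_nonneg (h0 x)]
    exact hb x
  have key := BoundedContinuousFunction.integral_le_of_levyProkhorovEDist_lt μ ν hε h f
    (Eventually.of_forall h0)
  have hint : Integrable (fun x => f x + ε) ν := (f.integrable ν).add (integrable_const ε)
  have hmono : ∫ t in Set.Ioc 0 ‖f‖, ν.real (Metric.thickening ε {a | t ≤ f a})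
      ≤ ∫ t in Set.Ioc 0 (‖f‖ + ε), ν.real {a | t ≤ f a + ε} := by
    have i2 : IntegrableOn (fun t => ν.real {a | t ≤ f a + ε}) (Set.Ioc 0 (‖f‖ + ε)) := by
      apply Measure.integrableOn_of_bounded (M := 1) measure_Ioc_lt_top.ne
      · apply (Measurable.ennreal_toReal (Antitone.measurable ?_)).aestronglyMeasurable
        exact fun _ _ hst => measure_mono fun _ h => hst.trans h
      · refine Eventually.of_forall fun t => ?_
        rw [Real.norm_eq_abs, abs_of_nonneg measureReal_nonneg]
        exact measureReal_le_one
    have i1 : IntegrableOn (fun t => ν.real (Metric.thickening ε {a | t ≤ f a}))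
        (Set.Ioc 0 ‖f‖) := by
      apply Measure.integrableOn_of_bounded (M := 1) measure_Ioc_lt_top.ne
      · apply (Measurable.ennreal_toReal (Antitone.measurable ?_)).aestronglyMeasurable
        exact fun _ _ hst => measure_mono <|
          Metric.thickening_subset_of_subset ε (fun _ h => hst.trans h)
      · refine Eventually.of_forall fun t => ?_
        rw [Real.norm_eq_abs, abs_of_nonneg measureReal_nonneg]
        exact measureReal_le_one
    have hsub : Set.Ioc 0 ‖f‖ ⊆ Set.Ioc 0 (‖f‖ + ε) := Set.Ioc_subset_Ioc_right (by linarith)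
    refine (setIntegral_mono i1 (i2.mono_set hsub) fun t => ?_).trans
      (setIntegral_mono_set i2 (Eventually.of_forall fun t => measureReal_nonneg)
        hsub.eventuallyLE)
    refine measureReal_mono fun x hx => ?_
    rw [Metric.mem_thickening_iff] at hx
    obtain ⟨z, hz, hxz⟩ := hx
    have := (abs_le.1 (hf x z)).1
    simp only [Set.mem_ofPred_eq] at hz ⊢
    linarith
  have hcake : ∫ x, (f x + ε) ∂ν = ∫ t in Set.Ioc 0 (‖f‖ + ε), ν.real {a | t ≤ f a + ε} :=
    hint.integral_eq_integral_Ioc_meas_le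
      (Eventually.of_forall fun x => by have := h0 x; simp only [Pi.zero_apply]; linarith)
      (Eventually.of_forall fun x => by
        have := BoundedContinuousFunction.apply_le_norm f x
        linarith)
  rw [integral_add (f.integrable ν) (integrable_const ε)] at hcake
  simp only [integral_const, probReal_univ, smul_eq_mul, one_mul] at hcake
  nlinarith

lemma abs_integral_sub_le_of_levyProkhorovEDist_lt (μ ν : Measure (Fin l → ℝ))
    [IsProbabilityMeasure μ] [IsProbabilityMeasure ν] {ε : ℝ} (hε : 0 < ε)
    (h : levyProkhorovEDist μ ν < ENNReal.ofReal ε) {g : (Fin l → ℝ) → ℝ} (hg : g ∈ BL1 l) :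
    |∫ v, g v ∂μ - ∫ v, g v ∂ν| ≤ 3 * ε := by
  obtain ⟨h1, h2⟩ := hg
  have hcont : Continuous g := by
    refine (LipschitzWith.of_dist_le_mul (K := 1) fun x y => ?_).continuous
    rw [Real.dist_eq, dist_eq_norm]
    simpa using h2 x y
  -- The layer-cake comparison needs a nonnegative function; `g + 1` takes values in `[0, 2]`,
  -- whence the factor `1 + 2 = 3`.
  let f : BoundedContinuousFunction (Fin l → ℝ) ℝ :=
    BoundedContinuousFunction.ofNormedAddCommGroup (fun x => g x + 1) (by fun_prop) 2 fun x => by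
      have := abs_le.1 (h1 x)
      rw [Real.norm_eq_abs, abs_le]
      constructor <;> linarith
  have hf : ∀ x, f x = g x + 1 := fun x => rfl
  have e : ∀ (ρ : Measure (Fin l → ℝ)) [IsProbabilityMeasure ρ],
      ∫ x, f x ∂ρ = ∫ x, g x ∂ρ + 1 := by
    intro ρ _
    have : Integrable g ρ := Integrable.of_bound hcont.aestronglyMeasurable 1
      (Eventually.of_forall fun x => by simpa using h1 x)
    simp_rw [hf]
    rw [integral_add this (integrable_const 1)]
    simp
  have f0 : ∀ x, 0 ≤ f x := fun x => by have := (abs_le.1 (h1 x)).1; rw [hf]; linarith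
  have f2 : ∀ x, f x ≤ 2 := fun x => by have := (abs_le.1 (h1 x)).2; rw [hf]; linarith
  have fl : ∀ x y, |f x - f y| ≤ dist x y := fun x y => by
    rw [hf, hf, add_sub_add_right_eq_sub, dist_eq_norm]
    exact h2 x y
  have a := integral_le_integral_add_of_levyProkhorovEDist_lt μ ν hε h f f0 f2 fl
  have b := integral_le_integral_add_of_levyProkhorovEDist_lt ν μ hε
    (by rwa [levyProkhorovEDist_comm]) f f0 f2 fl
  rw [e, e] at a b
  rw [abs_le]
  constructor <;> linarith

lemma dBL_nonneg (μ ν : Measure (Fin l → ℝ)) : 0 ≤ dBL μ ν :=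
  Real.sSup_nonneg (by rintro a ⟨g, -, rfl⟩; exact abs_nonneg _)

lemma dBL_le_of_levyProkhorovEDist_lt (μ ν : Measure (Fin l → ℝ))
    [IsProbabilityMeasure μ] [IsProbabilityMeasure ν] {ε : ℝ} (hε : 0 < ε)
    (h : levyProkhorovEDist μ ν < ENNReal.ofReal ε) : dBL μ ν ≤ 3 * ε :=
  Real.sSup_le (by
    rintro a ⟨g, hg, rfl⟩
    exact abs_integral_sub_le_of_levyProkhorovEDist_lt μ ν hε h hg) (by linarith)

lemma tendsto_dBL {μ : ℕ → ProbabilityMeasure (Fin l → ℝ)} {ν : ProbabilityMeasure (Fin l → ℝ)}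
    (h : Tendsto μ atTop (𝓝 ν)) :
    Tendsto (fun n => dBL (μ n : Measure (Fin l → ℝ)) ν) atTop (𝓝 0) := by
  have h' := (LevyProkhorov.continuous_ofMeasure_probabilityMeasure.tendsto ν).comp h
  rw [EMetric.tendsto_nhds] at h'
  rw [Metric.tendsto_nhds]
  intro ε hε
  filter_upwards [h' (ENNReal.ofReal (ε / 4)) (by positivity)] with n hn
  have := dBL_le_of_levyProkhorovEDist_lt (μ n : Measure (Fin l → ℝ)) ν
    (ε := ε / 4) (by positivity) (by simpa [LevyProkhorov.edist_probabilityMeasure_def] using hn)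
  rw [Real.dist_eq, sub_zero, abs_of_nonneg (dBL_nonneg _ _)]
  linarith

end BoundedLipschitz

/-! ### Central limit theorem for multipliers with deterministic weights. -/

section Multiplier

variable {l : ℕ}

/-- Lévy's continuity theorem. As `charFun` uses an inner product while `Fin l → ℝ` carries the
maximum norm, the laws are moved to `EuclideanSpace` and back by the identity map, a homeomorphism.
-/
lemma tendsto_of_tendsto_integral_exp {μ : ℕ → ProbabilityMeasure (Fin l → ℝ)}
    {ν : ProbabilityMeasure (Fin l → ℝ)}
    (h : ∀ t : Fin l → ℝ, Tendsto
      (fun n => ∫ x, Complex.exp ((∑ k, t k * x k : ℝ) * Complex.I) ∂(μ n : Measure (Fin l → ℝ)))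
      atTop (𝓝 (∫ x, Complex.exp ((∑ k, t k * x k : ℝ) * Complex.I) ∂(ν : Measure (Fin l → ℝ))))) :
    Tendsto μ atTop (𝓝 ν) := by
  have c1 : Continuous (WithLp.toLp 2 : (Fin l → ℝ) → EuclideanSpace ℝ (Fin l)) :=
    PiLp.continuous_toLp 2 _
  have c2 : Continuous (WithLp.ofLp : EuclideanSpace ℝ (Fin l) → (Fin l → ℝ)) :=
    PiLp.continuous_ofLp 2 _
  have key : Tendsto (fun n => (μ n).map c1.aemeasurable) atTop (𝓝 (ν.map c1.aemeasurable)) := by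
    refine ProbabilityMeasure.tendsto_of_tendsto_charFun fun t => ?_
    have e : ∀ ρ : ProbabilityMeasure (Fin l → ℝ),
        charFun ((ρ.map c1.aemeasurable : ProbabilityMeasure _) : Measure _) t
          = ∫ x, Complex.exp ((∑ k, t k * x k : ℝ) * Complex.I) ∂(ρ : Measure (Fin l → ℝ)) := by
      intro ρ
      rw [ProbabilityMeasure.toMeasure_map, charFun_apply,
        integral_map c1.aemeasurable (by fun_prop)]
      simp [PiLp.inner_apply, mul_comm]
    simp_rw [e]
    exact h t
  have := ProbabilityMeasure.tendsto_map_of_tendsto_of_continuous _ _ key c2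
  have e : ∀ ρ : ProbabilityMeasure (Fin l → ℝ),
      (ρ.map c1.aemeasurable).map c2.aemeasurable = ρ := by
    intro ρ
    apply ProbabilityMeasure.toMeasure_injective
    rw [ProbabilityMeasure.toMeasure_map, ProbabilityMeasure.toMeasure_map,
      Measure.map_map c2.measurable c1.measurable]
    exact Measure.map_id
  simpa only [e] using this

lemma norm_prod_sub_prod_le {ι : Type*} (s : Finset ι) (a b : ι → ℂ) (ha : ∀ i ∈ s, ‖a i‖ ≤ 1)
    (hb : ∀ i ∈ s, ‖b i‖ ≤ 1) : ‖∏ i ∈ s, a i - ∏ i ∈ s, b i‖ ≤ ∑ i ∈ s, ‖a i - b i‖ := by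
  classical
  induction s using Finset.induction_on with
  | empty => simp
  | insert i s hi ih =>
    rw [Finset.prod_insert hi, Finset.prod_insert hi, Finset.sum_insert hi]
    have h1 : ‖∏ i ∈ s, b i‖ ≤ 1 := by
      rw [norm_prod]
      exact Finset.prod_le_one (fun _ _ => norm_nonneg _)
        fun j hj => hb j (Finset.mem_insert_of_mem hj)
    have h2 := ih (fun j hj => ha j (Finset.mem_insert_of_mem hj))
      (fun j hj => hb j (Finset.mem_insert_of_mem hj))
    have h3 := ha i (Finset.mem_insert_self i s)
    calc ‖a i * ∏ i ∈ s, a i - b i * ∏ i ∈ s, b i‖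
        = ‖a i * (∏ i ∈ s, a i - ∏ i ∈ s, b i) + (a i - b i) * ∏ i ∈ s, b i‖ := by ring_nf
      _ ≤ ‖a i‖ * ‖∏ i ∈ s, a i - ∏ i ∈ s, b i‖ + ‖a i - b i‖ * ‖∏ i ∈ s, b i‖ := by
        rw [← norm_mul, ← norm_mul]; exact norm_add_le _ _
      _ ≤ 1 * ‖∏ i ∈ s, a i - ∏ i ∈ s, b i‖ + ‖a i - b i‖ * 1 := by gcongr
      _ ≤ ‖a i - b i‖ + ∑ i ∈ s, ‖a i - b i‖ := by linarith

/-- Products of a characteristic function with mean zero and variance one, over a uniformly small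
triangular array with convergent sums of squares. -/
lemma tendsto_prod_charFun {Ω : Type*} [MeasurableSpace Ω] {P : Measure Ω} [IsProbabilityMeasure P]
    {ζ : Ω → ℝ} (hζ : AEMeasurable ζ P) (h0 : P[ζ] = 0) (h1 : P[ζ ^ 2] = 1)
    (M : ℕ → ℕ) (a : ℕ → ℕ → ℝ) {v : ℝ}
    (hsq : Tendsto (fun n => ∑ j ∈ Finset.range (M n), a n j ^ 2) atTop (𝓝 v))
    (hmax : ∀ δ > 0, ∀ᶠ n in atTop, ∀ j < M n, |a n j| ≤ δ) :
    Tendsto (fun n => ∏ j ∈ Finset.range (M n), charFun (P.map ζ) (a n j)) atTop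
      (𝓝 (Complex.exp (-(v / 2 : ℝ)))) := by
  have : IsProbabilityMeasure (P.map ζ) := Measure.isProbabilityMeasure_map hζ
  have hexp : (fun t : ℝ => Complex.exp (-(t ^ 2 / 2 : ℝ)) - (1 - t ^ 2 / 2)) =o[𝓝 0]
      fun t => t ^ 2 := by
    have e1 : (fun z : ℂ => Complex.exp z - 1 - z) =o[𝓝 0] fun z => z := by
      have := (Complex.hasDerivAt_exp 0).isLittleO
      simpa using this
    have t1 : Tendsto (fun t : ℝ => (-(t ^ 2 / 2 : ℝ) : ℂ)) (𝓝 0) (𝓝 0) := by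
      have : Continuous (fun t : ℝ => (-(t ^ 2 / 2 : ℝ) : ℂ)) := by fun_prop
      simpa using this.tendsto 0
    have e2 := e1.comp_tendsto t1
    refine IsLittleO.congr' (e2.trans_isBigO ?_) (g₂ := fun t : ℝ => t ^ 2) ?_ EventuallyEq.rfl
    · refine IsBigO.of_bound 1 (Eventually.of_forall fun t => ?_)
      simp only [Function.comp_apply, norm_neg, Complex.norm_real, one_mul]
      rw [Real.norm_of_nonneg (by positivity), Real.norm_of_nonneg (by positivity)]
      nlinarith [sq_nonneg t]
    · refine Eventually.of_forall fun t => ?_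
      simp only [Function.comp_apply]
      push_cast
      ring
  -- Both functions are `1 - t² / 2 + o(t²)`, so each factor may be replaced by its Gaussian
  -- counterpart, whose product is explicit.
  have hdiff : (fun t : ℝ => charFun (P.map ζ) t - Complex.exp (-(t ^ 2 / 2 : ℝ))) =o[𝓝 0]
      fun t => t ^ 2 := by
    refine ((taylor_charFun_two hζ h0 h1).sub hexp).congr (fun t => ?_) (fun t => rfl)
    ring
  have hlim : Tendsto (fun n => ∏ j ∈ Finset.range (M n), Complex.exp (-(a n j ^ 2 / 2 : ℝ))) atTop
      (𝓝 (Complex.exp (-(v / 2 : ℝ)))) := by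
    have e : ∀ n, ∏ j ∈ Finset.range (M n), Complex.exp (-(a n j ^ 2 / 2 : ℝ))
        = Complex.exp (-((∑ j ∈ Finset.range (M n), a n j ^ 2) / 2 : ℝ)) := by
      intro n
      rw [← Complex.exp_sum, Finset.sum_neg_distrib, Finset.sum_div, Complex.ofReal_sum]
    simp_rw [e]
    have : Continuous (fun x : ℝ => Complex.exp (-(x / 2 : ℝ))) := by fun_prop
    exact (this.tendsto v).comp hsq
  have hzero : Tendsto (fun n => ∏ j ∈ Finset.range (M n), charFun (P.map ζ) (a n j)
      - ∏ j ∈ Finset.range (M n), Complex.exp (-(a n j ^ 2 / 2 : ℝ))) atTop (𝓝 0) := by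
    rw [Metric.tendsto_nhds]
    intro ε hε
    have hv : 0 ≤ v := ge_of_tendsto' hsq fun n => Finset.sum_nonneg fun _ _ => sq_nonneg _
    -- Eventually the sum of squares is below `v + 1`, so this constant makes the total replacement
    -- error at most `ε / 2`.
    obtain ⟨δ, hδ, hb⟩ := Metric.eventually_nhds_iff.1 (hdiff.bound (c := ε / (2 * (v + 1)))
      (by positivity))
    filter_upwards [hmax (δ / 2) (by positivity), hsq.eventually_lt_const (show v < v + 1 by simp)]
      with n hn hn'
    rw [dist_zero_right]
    refine (norm_prod_sub_prod_le _ _ _ (fun j _ => norm_charFun_le_one _) fun j _ => ?_).trans_lt ?_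
    · rw [← Complex.ofReal_neg, Complex.norm_exp_ofReal]
      exact Real.exp_le_one_iff.2 (by have := sq_nonneg (a n j); linarith)
    · calc ∑ j ∈ Finset.range (M n), ‖charFun (P.map ζ) (a n j) - Complex.exp (-(a n j ^ 2 / 2 : ℝ))‖
          ≤ ∑ j ∈ Finset.range (M n), ε / (2 * (v + 1)) * a n j ^ 2 := by
            refine Finset.sum_le_sum fun j hj => ?_
            have := hb (y := a n j) (by
              rw [dist_zero_right, Real.norm_eq_abs]
              exact (hn j (Finset.mem_range.1 hj)).trans_lt (by linarith))
            rwa [Real.norm_of_nonneg (sq_nonneg _)] at this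
        _ = ε / (2 * (v + 1)) * ∑ j ∈ Finset.range (M n), a n j ^ 2 := by rw [Finset.mul_sum]
        _ ≤ ε / (2 * (v + 1)) * (v + 1) := by gcongr
        _ = ε / 2 := by field_simp
        _ < ε := by linarith
  simpa using hzero.add hlim

/-- A central limit theorem for sums `∑ j, ξ j * w j` with deterministic weight vectors `w j`. -/
lemma tendsto_dBL_weighted_sum {Ω : Type*} [MeasurableSpace Ω] {P : Measure Ω}
    [IsProbabilityMeasure P] {ξ : ℕ → Ω → ℝ} (hm : ∀ j, Measurable (ξ j)) (hi : iIndepFun ξ P)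
    (hid : ∀ j, IdentDistrib (ξ j) (ξ 0) P P) (h0 : P[ξ 0] = 0) (h1 : P[ξ 0 ^ 2] = 1)
    (C : Fin l → Fin l → ℝ) (ν : Measure (Fin l → ℝ)) [IsProbabilityMeasure ν]
    (hν : ∀ t : Fin l → ℝ, ∫ x, Complex.exp ((∑ k, t k * x k : ℝ) * Complex.I) ∂ν
      = Complex.exp (-((∑ k, ∑ k', t k * t k' * C k k') / 2 : ℝ)))
    (M : ℕ → ℕ) (w : ℕ → ℕ → Fin l → ℝ)
    (hsq : ∀ k k', Tendsto (fun n => ∑ j ∈ Finset.range (M n), w n j k * w n j k') atTop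
      (𝓝 (C k k')))
    (hmax : ∀ δ > 0, ∀ᶠ n in atTop, ∀ j < M n, ∀ k, |w n j k| ≤ δ) :
    Tendsto (fun n => dBL (P.map fun ω k => ∑ j ∈ Finset.range (M n), ξ j ω * w n j k) ν)
      atTop (𝓝 0) := by
  have hmeas : ∀ n, Measurable fun ω (k : Fin l) => ∑ j ∈ Finset.range (M n), ξ j ω * w n j k :=
    fun n => measurable_pi_lambda _ fun k => Finset.measurable_sum _ fun j _ => (hm j).mul_const _
  have hp : ∀ n, IsProbabilityMeasure
      (P.map fun ω (k : Fin l) => ∑ j ∈ Finset.range (M n), ξ j ω * w n j k) :=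
    fun n => Measure.isProbabilityMeasure_map (hmeas n).aemeasurable
  refine tendsto_dBL (μ := fun n => ⟨_, hp n⟩) (ν := ⟨ν, inferInstance⟩) ?_
  refine tendsto_of_tendsto_integral_exp fun t => ?_
  simp only [ProbabilityMeasure.coe_mk]
  rw [hν]
  have e : ∀ n, ∫ x, Complex.exp ((∑ k, t k * x k : ℝ) * Complex.I)
      ∂(P.map fun ω (k : Fin l) => ∑ j ∈ Finset.range (M n), ξ j ω * w n j k)
      = ∏ j ∈ Finset.range (M n), charFun (P.map (ξ 0)) (∑ k, t k * w n j k) := by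
    intro n
    have hind : iIndepFun (fun j ω => (∑ k, t k * w n j k) * ξ j ω) P :=
      hi.comp (fun j x => (∑ k, t k * w n j k) * x) (fun j => measurable_const.mul measurable_id)
    -- Cramér–Wold: the projection on `t` is a real sum of independent terms with scalar weights `∑
    -- k, t k * w n j k`, whose characteristic function is taken at 1.
    have hc := congrFun ((hind.restrict _).charFun_map_fun_finsetSum_eq_prod
      (s := Finset.range (M n)) (X := fun j ω => (∑ k, t k * w n j k) * ξ j ω)
      (fun j _ => ((hm j).const_mul _).aemeasurable)) 1
    rw [Finset.prod_apply, charFun_apply_real, integral_map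
      (Finset.measurable_sum _ fun j _ => (hm j).const_mul _).aemeasurable (by fun_prop)] at hc
    rw [integral_map (hmeas n).aemeasurable
      (Continuous.aestronglyMeasurable (by fun_prop))]
    refine Eq.trans ?_ (hc.trans (Finset.prod_congr rfl fun j _ => ?_))
    · refine integral_congr_ae (Eventually.of_forall fun ω => ?_)
      have : ∑ k, t k * ∑ j ∈ Finset.range (M n), ξ j ω * w n j k
          = ∑ j ∈ Finset.range (M n), (∑ k, t k * w n j k) * ξ j ω := by
        simp_rw [Finset.mul_sum, Finset.sum_mul]
        rw [Finset.sum_comm]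
        exact Finset.sum_congr rfl fun j _ => Finset.sum_congr rfl fun k _ => by ring
      simp only [this, Complex.ofReal_one, one_mul]
    · rw [charFun_map_mul_comp (hm j).aemeasurable, mul_one, (hid j).map_eq]
  simp_rw [e]
  refine tendsto_prod_charFun (hm 0).aemeasurable h0 h1 M _ ?_ ?_
  · have : ∀ n, ∑ j ∈ Finset.range (M n), (∑ k, t k * w n j k) ^ 2
        = ∑ k, ∑ k', t k * t k' * ∑ j ∈ Finset.range (M n), w n j k * w n j k' := by
      intro n
      simp_rw [sq, Finset.sum_mul_sum, Finset.mul_sum]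
      rw [Finset.sum_comm]
      refine Finset.sum_congr rfl fun k _ => ?_
      rw [Finset.sum_comm]
      exact Finset.sum_congr rfl fun k' _ => Finset.sum_congr rfl fun j _ => by ring
    simp_rw [this]
    exact tendsto_finsetSum _ fun k _ => tendsto_finsetSum _ fun k' _ => (hsq k k').const_mul _
  · intro δ hδ
    filter_upwards [hmax (δ / (∑ k, |t k| + 1)) (by positivity)] with n hn j hj
    calc |∑ k, t k * w n j k| ≤ ∑ k, |t k| * (δ / (∑ k, |t k| + 1)) := by
          refine (Finset.abs_sum_le_sum_abs _ _).trans (Finset.sum_le_sum fun k _ => ?_)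
          rw [abs_mul]
          exact mul_le_mul_of_nonneg_left (hn j hj k) (abs_nonneg _)
      _ = δ * ((∑ k, |t k|) / (∑ k, |t k| + 1)) := by rw [← Finset.sum_mul]; ring
      _ ≤ δ * 1 := by
          gcongr
          exact div_le_one_of_le₀ (by linarith) (by positivity)
      _ = δ := mul_one δ

/-- Counterexamples for `δ = 1 / (n + 1)`, `n ∈ ℕ`, would form an array of weights that violates the
central limit theorem. The uniformity in `M` and `w` is what allows random weights later on, with no
passage to almost surely convergent subsequences. -/
lemma exists_forall_dBL_weighted_sum_lt {Ω : Type*} [MeasurableSpace Ω] {P : Measure Ω}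
    [IsProbabilityMeasure P] {ξ : ℕ → Ω → ℝ} (hm : ∀ j, Measurable (ξ j)) (hi : iIndepFun ξ P)
    (hid : ∀ j, IdentDistrib (ξ j) (ξ 0) P P) (h0 : P[ξ 0] = 0) (h1 : P[ξ 0 ^ 2] = 1)
    (C : Fin l → Fin l → ℝ) (ν : Measure (Fin l → ℝ)) [IsProbabilityMeasure ν]
    (hν : ∀ t : Fin l → ℝ, ∫ x, Complex.exp ((∑ k, t k * x k : ℝ) * Complex.I) ∂ν
      = Complex.exp (-((∑ k, ∑ k', t k * t k' * C k k') / 2 : ℝ))) {ε : ℝ} (hε : 0 < ε) :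
    ∃ δ > 0, ∀ (M : ℕ) (w : ℕ → Fin l → ℝ),
      (∀ k k', |∑ j ∈ Finset.range M, w j k * w j k' - C k k'| ≤ δ) →
      (∀ j < M, ∀ k, |w j k| ≤ δ) →
      dBL (P.map fun ω k => ∑ j ∈ Finset.range M, ξ j ω * w j k) ν < ε := by
  by_contra! H
  choose M w h2 h3 h4 using fun n : ℕ => H (1 / ((n : ℝ) + 1)) (by positivity)
  have hlim := tendsto_one_div_add_atTop_nhds_zero_nat (𝕜 := ℝ)
  have := tendsto_dBL_weighted_sum hm hi hid h0 h1 C ν hν M w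
    (fun k k' => tendsto_iff_norm_sub_tendsto_zero.2 <|
      squeeze_zero (fun n => norm_nonneg _) (fun n => h2 n k k') hlim)
    (fun δ hδ => by
      filter_upwards [hlim.eventually_lt_const hδ] with n hn j hj k
      exact (h3 n j hj k).trans hn.le)
  exact absurd (ge_of_tendsto' this h4) (not_le.2 hε)

end Multiplier

/-! ### Characteristic functions of the Gaussian limit. -/

section Gaussian

lemma IsCentredGaussianProcess.integral_exp {Ω T : Type*} [MeasurableSpace Ω] {P : Measure Ω}
    [IsProbabilityMeasure P] {Z : T → Ω → ℝ} {c : T → T → ℝ} (h : IsCentredGaussianProcess P Z c)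
    {l : ℕ} (f : Fin l → T) (t : Fin l → ℝ) :
    ∫ x, Complex.exp ((∑ k, t k * x k : ℝ) * Complex.I) ∂(P.map fun ω k => Z (f k) ω)
      = Complex.exp (-((∑ k, ∑ k', t k * t k' * c (f k) (f k')) / 2 : ℝ)) := by
  have hm : ∀ s, AEMeasurable (Z s) P := h.gaussian.aemeasurable
  have hg : HasGaussianLaw (fun ω => ∑ k, t k * Z (f k) ω) P := by
    have h1 : IsGaussianProcess (fun k ω => t k * Z (f k) ω) P :=
      (h.gaussian.comp_right f).smul t
    exact h1.hasGaussianLaw_fun_sum (I := Finset.univ)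
  have hL : ∀ s, MemLp (Z s) 2 P := fun s => (h.gaussian.hasGaussianLaw_eval s).memLp_two
  have hmean : P[fun ω => ∑ k, t k * Z (f k) ω] = 0 := by
    rw [integral_finsetSum _ fun k _ => ((hL _).integrable one_le_two).const_mul _]
    simp [integral_const_mul, h.mean_zero]
  have hvar : Var[fun ω => ∑ k, t k * Z (f k) ω; P]
      = ∑ k, ∑ k', t k * t k' * c (f k) (f k') := by
    rw [variance_fun_sum fun k => (hL _).const_mul _]
    refine Finset.sum_congr rfl fun k _ => Finset.sum_congr rfl fun k' _ => ?_
    rw [covariance_const_mul_left, covariance_const_mul_right, h.cov_eq]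
    ring
  have hc := congrFun (congrArg charFun hg.map_eq_gaussianReal) 1
  rw [charFun_gaussianReal, hmean, hvar, charFun_apply_real,
    integral_map hg.aemeasurable (by fun_prop)] at hc
  rw [integral_map (aemeasurable_pi_lambda _ fun k => hm _)
    (Continuous.aestronglyMeasurable (by fun_prop))]
  rw [Real.coe_toNNReal _ (hvar ▸ variance_nonneg _ _)] at hc
  simpa using hc

end Gaussian

/-! ### Factorization of expectations over separated blocks under β-mixing. -/

section Mixing

/-- By the layer-cake formula, the difference is the integral over `t ∈ (0, 1]` of the difference of
the measures of `{t ≤ φ}`, each at most `b`. -/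
lemma abs_integral_sub_integral_le {α : Type*} [MeasurableSpace α] (μ ν : Measure α)
    [IsProbabilityMeasure μ] [IsProbabilityMeasure ν] {b : ℝ}
    (h : ∀ C, MeasurableSet C → |μ.real C - ν.real C| ≤ b) {φ : α → ℝ} (hφ : Measurable φ)
    (h0 : ∀ x, 0 ≤ φ x) (h1 : ∀ x, φ x ≤ 1) : |∫ x, φ x ∂μ - ∫ x, φ x ∂ν| ≤ b := by
  have cake : ∀ (ρ : Measure α) [IsProbabilityMeasure ρ],
      ∫ x, φ x ∂ρ = ∫ t in Set.Ioc 0 1, ρ.real {a | t ≤ φ a} := fun ρ _ =>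
    (Integrable.of_bound hφ.aestronglyMeasurable 1 (Eventually.of_forall fun x => by
      rw [Real.norm_of_nonneg (h0 x)]; exact h1 x)).integral_eq_integral_Ioc_meas_le
      (Eventually.of_forall h0) (Eventually.of_forall h1)
  have hint : ∀ (ρ : Measure α) [IsProbabilityMeasure ρ],
      IntegrableOn (fun t => ρ.real {a | t ≤ φ a}) (Set.Ioc 0 1) := by
    intro ρ _
    apply Measure.integrableOn_of_bounded (M := 1) measure_Ioc_lt_top.ne
    · apply (Measurable.ennreal_toReal (Antitone.measurable ?_)).aestronglyMeasurable
      exact fun _ _ hst => measure_mono fun _ h => hst.trans h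
    · refine Eventually.of_forall fun t => ?_
      rw [Real.norm_eq_abs, abs_of_nonneg measureReal_nonneg]
      exact measureReal_le_one
  rw [cake μ, cake ν, ← integral_sub (hint μ) (hint ν), ← Real.norm_eq_abs]
  have := norm_setIntegral_le_of_norm_le_const (μ := volume) (s := Set.Ioc (0 : ℝ) 1) (C := b)
    (f := fun t => μ.real {a | t ≤ φ a} - ν.real {a | t ≤ φ a}) measure_Ioc_lt_top
    (fun t _ => h _ (hφ measurableSet_Ici))
  simpa using this

variable {Ω : Type*} [MeasurableSpace Ω] {P : Measure Ω} {d : ℕ} {X : ℕ → ℕ → Ω → (Fin d → ℝ)}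

lemma measurable_segment (hX : ∀ n i : ℕ, i < n → Measurable (X n i)) {n a k : ℕ}
    (h : a + k ≤ n) : Measurable (segment X n a k) :=
  measurable_pi_lambda _ fun i => hX n _ (by omega)

lemma betaCoeff_nonneg (n k : ℕ) : 0 ≤ betaCoeff P X n k :=
  Real.sSup_nonneg (by rintro a ⟨m, C, -, -, -, rfl⟩; exact abs_nonneg _)

/-- The covariance of bounded functions of the past and of the future is at most `β_{n,k}`. -/
lemma abs_integral_mul_sub_le_betaCoeff [IsProbabilityMeasure P]
    (hX : ∀ n i : ℕ, i < n → Measurable (X n i))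
    {n k m : ℕ} (hm : 1 ≤ m) (hmn : m + k + 1 ≤ n)
    {G : (Fin m → (Fin d → ℝ)) → ℝ} {h : (Fin (n - (m + k)) → (Fin d → ℝ)) → ℝ}
    (hG : Measurable G) (hh : Measurable h) (G0 : ∀ x, 0 ≤ G x) (G1 : ∀ x, G x ≤ 1)
    (h0 : ∀ x, 0 ≤ h x) (h1 : ∀ x, h x ≤ 1) :
    |∫ ω, G (segment X n 0 m ω) * h (segment X n (m + k) (n - (m + k)) ω) ∂P
      - (∫ ω, G (segment X n 0 m ω) ∂P) * ∫ ω, h (segment X n (m + k) (n - (m + k)) ω) ∂P|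
      ≤ betaCoeff P X n k := by
  have s1 : Measurable (segment X n 0 m) := measurable_segment hX (by omega)
  have s2 : Measurable (segment X n (m + k) (n - (m + k))) := measurable_segment hX (by omega)
  have := Measure.isProbabilityMeasure_map (μ := P) s1.aemeasurable
  have := Measure.isProbabilityMeasure_map (μ := P) s2.aemeasurable
  have := Measure.isProbabilityMeasure_map (μ := P) (s1.prodMk s2).aemeasurable
  have key := abs_integral_sub_integral_le
    (P.map fun ω => (segment X n 0 m ω, segment X n (m + k) (n - (m + k)) ω))
    ((P.map (segment X n 0 m)).prod (P.map (segment X n (m + k) (n - (m + k)))))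
    (b := betaCoeff P X n k) (φ := fun p => G p.1 * h p.2) (fun C hC => ?_)
    ((hG.comp measurable_fst).mul (hh.comp measurable_snd))
    (fun p => mul_nonneg (G0 _) (h0 _)) (fun p => mul_le_one₀ (G1 _) (h0 _) (h1 _))
  · have hm2 : Measurable fun p : (Fin m → (Fin d → ℝ)) × (Fin (n - (m + k)) → (Fin d → ℝ)) =>
        G p.1 * h p.2 := (hG.comp measurable_fst).mul (hh.comp measurable_snd)
    rw [integral_prod_mul, integral_map (s1.prodMk s2).aemeasurable hm2.aestronglyMeasurable,
      integral_map s1.aemeasurable hG.aestronglyMeasurable,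
      integral_map s2.aemeasurable hh.aestronglyMeasurable] at key
    exact key
  -- A real supremum dominates its elements only if the set is bounded; differences of probabilities
  -- are bounded by 1.
  · refine le_csSup ⟨1, ?_⟩ ⟨m, C, hm, hmn, hC, rfl⟩
    rintro b ⟨m', C', -, hmn', -, rfl⟩
    have s1 : Measurable (segment X n 0 m') := measurable_segment hX (by omega)
    have s2 : Measurable (segment X n (m' + k) (n - (m' + k))) := measurable_segment hX (by omega)
    have := Measure.isProbabilityMeasure_map (μ := P) s1.aemeasurable
    have := Measure.isProbabilityMeasure_map (μ := P) s2.aemeasurable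
    have := Measure.isProbabilityMeasure_map (μ := P) (s1.prodMk s2).aemeasurable
    exact abs_sub_le_of_nonneg_of_le measureReal_nonneg measureReal_le_one measureReal_nonneg
      measureReal_le_one

lemma integral_comp_segment (hX : ∀ n i : ℕ, i < n → Measurable (X n i))
    (hs : RowwiseStationary P X) {n a k : ℕ} (h : a + k ≤ n)
    {g : (Fin k → (Fin d → ℝ)) → ℝ} (hg : Measurable g) :
    ∫ ω, g (segment X n a k ω) ∂P = ∫ ω, g (segment X n 0 k ω) ∂P := by
  rw [← integral_map (measurable_segment hX h).aemeasurable hg.aestronglyMeasurable, hs n a k h,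
    integral_map (measurable_segment hX (by omega)).aemeasurable hg.aestronglyMeasurable]

/-- Every second block of length `r`: the expectation of a product of functions of these blocks
factorizes up to mixing coefficients. -/
lemma abs_integral_prod_blocks_sub_le [IsProbabilityMeasure P]
    (hX : ∀ n i : ℕ, i < n → Measurable (X n i))
    (hs : RowwiseStationary P X) {n r k : ℕ} (hr : 1 ≤ r) (hk : k ≤ r)
    {g : (Fin r → (Fin d → ℝ)) → ℝ} (hg : Measurable g) (g0 : ∀ x, 0 ≤ g x) (g1 : ∀ x, g x ≤ 1)
    (p K : ℕ) (hK : (2 * K + p) * r ≤ n + r) :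
    |∫ ω, ∏ i ∈ Finset.range K, g (segment X n ((2 * i + p) * r) r ω) ∂P
      - (∫ ω, g (segment X n 0 r ω) ∂P) ^ K| ≤ K * betaCoeff P X n k := by
  have e0 : 0 ≤ ∫ ω, g (segment X n 0 r ω) ∂P := integral_nonneg fun _ => g0 _
  have e1 : ∫ ω, g (segment X n 0 r ω) ∂P ≤ 1 := by
    refine (integral_mono_of_nonneg (Eventually.of_forall fun _ => g0 _) (integrable_const 1)
      (Eventually.of_forall fun _ => g1 _)).trans ?_
    simp
  -- The last block is split off in each step, at the cost of one mixing coefficient. The bound `hK`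
  -- says that the last block, number `2 * (K - 1) + p`, ends within the row, without a natural
  -- subtraction.
  induction K with
  | zero => simp
  | succ K ih =>
    have hK' : (2 * K + p + 1) * r ≤ n := by
      have : (2 * (K + 1) + p) * r = (2 * K + p + 1) * r + r := by ring
      omega
    have ih := ih (by nlinarith)
    have hst : ∫ ω, g (segment X n ((2 * K + p) * r) r ω) ∂P = ∫ ω, g (segment X n 0 r ω) ∂P :=
      integral_comp_segment hX hs (by rw [add_mul, one_mul] at hK'; exact hK') hg
    -- A single block has no past to be separated from; stationarity alone settles this case.
    rcases Nat.eq_zero_or_pos K with rfl | hKpos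
    · simp only [zero_add, Finset.range_one, Finset.prod_singleton, pow_one]
      rw [hst]
      simpa using betaCoeff_nonneg n k
    -- Block `q` is the skipped one just before the last block: the past consists of the first `q *
    -- r` variables, and the future starts `k ≤ r` positions later, hence `r - k` positions before
    -- the last block. The default value 0 in `G` is never reached, because the earlier blocks end
    -- by position `q * r`.
    obtain ⟨q, hq⟩ : ∃ q, 2 * K + p = q + 1 := ⟨2 * K + p - 1, by omega⟩
    have hq1 : 1 ≤ q := by omega
    have hm1 : 1 ≤ q * r := Nat.mul_pos hq1 hr
    have hlast : (2 * K + p) * r = q * r + r := by rw [hq]; ring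
    have hn : q * r + r + r ≤ n := by rw [← hlast]; rw [add_mul, one_mul] at hK'; exact hK'
    let G : (Fin (q * r) → (Fin d → ℝ)) → ℝ := fun x => ∏ i ∈ Finset.range K,
      g fun a => if h : (2 * i + p) * r + a < q * r then x ⟨_, h⟩ else 0
    let h : (Fin (n - (q * r + k)) → (Fin d → ℝ)) → ℝ := fun y =>
      g fun a => y ⟨r - k + a, by have := a.2; omega⟩
    have hGe : ∀ ω, G (segment X n 0 (q * r) ω)
        = ∏ i ∈ Finset.range K, g (segment X n ((2 * i + p) * r) r ω) := by
      intro ω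
      refine Finset.prod_congr rfl fun i hi => congrArg g (funext fun a => ?_)
      have hlt : (2 * i + p) * r + a < q * r := by
        have h1 : (2 * i + p + 1) * r ≤ q * r :=
          Nat.mul_le_mul_right _ (by have := Finset.mem_range.1 hi; omega)
        rw [add_mul, one_mul] at h1
        have := a.2
        omega
      simp only [hlt, dite_true, segment, zero_add]
    have hhe : ∀ ω, h (segment X n (q * r + k) (n - (q * r + k)) ω)
        = g (segment X n ((2 * K + p) * r) r ω) := by
      intro ω
      refine congrArg g (funext fun a => ?_)
      have : q * r + k + (r - k + a) = (2 * K + p) * r + a := by omega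
      simp only [segment, this]
    have hGm : Measurable G := by
      refine Finset.measurable_prod _ fun i _ => hg.comp (measurable_pi_lambda _ fun a => ?_)
      by_cases h : (2 * i + p) * r + a < q * r
      · simp only [h, dite_true]
        exact measurable_pi_apply _
      · simp only [h, dite_false]
        exact measurable_const
    have hhm : Measurable h := hg.comp (measurable_pi_lambda _ fun a => measurable_pi_apply _)
    have key := abs_integral_mul_sub_le_betaCoeff (P := P) hX (k := k) hm1 (by omega) hGm hhm
      (fun x => Finset.prod_nonneg fun _ _ => g0 _)
      (fun x => Finset.prod_le_one (fun _ _ => g0 _) fun _ _ => g1 _)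
      (fun x => g0 _) (fun x => g1 _)
    simp only [hGe, hhe] at key
    rw [hst] at key
    simp_rw [Finset.prod_range_succ, pow_succ]
    set e := ∫ ω, g (segment X n 0 r ω) ∂P
    set I := ∫ ω, ∏ i ∈ Finset.range K, g (segment X n ((2 * i + p) * r) r ω) ∂P
    have h3 : |(I - e ^ K) * e| ≤ K * betaCoeff P X n k := by
      rw [abs_mul, abs_of_nonneg e0]
      exact (mul_le_of_le_one_right (abs_nonneg _) e1).trans ih
    rw [abs_le] at key h3 ⊢
    push_cast
    constructor <;> linarith

end Mixing

/-! ### Laplace transforms: expansion of one factor, and convergence in probability. -/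

section Laplace

lemma abs_exp_neg_sub_one_add_le_self {x : ℝ} (hx : 0 ≤ x) : |Real.exp (-x) - 1 + x| ≤ x := by
  have h1 := Real.add_one_le_exp (-x)
  have h2 : Real.exp (-x) ≤ 1 := Real.exp_le_one_iff.2 (by linarith)
  rw [abs_le]
  constructor <;> linarith

lemma abs_exp_neg_sub_one_add_le_sq {x : ℝ} (hx : 0 ≤ x) : |Real.exp (-x) - 1 + x| ≤ x ^ 2 := by
  rcases le_total x 1 with h | h
  · have := Real.abs_exp_sub_one_sub_id_le (x := -x) (by rwa [abs_neg, abs_of_nonneg hx])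
    simpa using this
  · exact (abs_exp_neg_sub_one_add_le_self hx).trans (by nlinarith)

variable {Ω : Type*} [MeasurableSpace Ω] {P : Measure Ω} [IsProbabilityMeasure P]

/-- Both terms are compared with `1 - lam * E A²`. The error `|exp (-x) - 1 + x|` is bounded by `x`
where `|A| > δ` and by `x²` elsewhere; the last summand comes from the second exponential. Summed
over the blocks, the three terms are controlled by the Lindeberg condition, by small `δ`, and by the
growing number of blocks. -/
lemma abs_integral_exp_neg_sq_sub_le {A : Ω → ℝ} (hA : Measurable A)
    (hint : Integrable (fun ω => A ω ^ 2) P) {lam δ : ℝ} (hl : 0 ≤ lam) :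
    |∫ ω, Real.exp (-(lam * A ω ^ 2)) ∂P - Real.exp (-(lam * ∫ ω, A ω ^ 2 ∂P))|
      ≤ lam * ∫ ω in {ω | δ < |A ω|}, A ω ^ 2 ∂P + lam ^ 2 * δ ^ 2 * ∫ ω, A ω ^ 2 ∂P
        + lam ^ 2 * (∫ ω, A ω ^ 2 ∂P) ^ 2 := by
  have hS : MeasurableSet {ω | δ < |A ω|} := measurableSet_lt measurable_const hA.abs
  have hnn : 0 ≤ ∫ ω, A ω ^ 2 ∂P := integral_nonneg fun _ => sq_nonneg _
  have hexp : Integrable (fun ω => Real.exp (-(lam * A ω ^ 2))) P := by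
    refine Integrable.of_bound (by fun_prop) 1 (Eventually.of_forall fun ω => ?_)
    rw [Real.norm_of_nonneg (Real.exp_pos _).le]
    exact Real.exp_le_one_iff.2 (by have := mul_nonneg hl (sq_nonneg (A ω)); linarith)
  have h1 : |∫ ω, Real.exp (-(lam * A ω ^ 2)) ∂P - 1 + lam * ∫ ω, A ω ^ 2 ∂P|
      ≤ lam * ∫ ω in {ω | δ < |A ω|}, A ω ^ 2 ∂P + lam ^ 2 * δ ^ 2 * ∫ ω, A ω ^ 2 ∂P := by
    have e : ∫ ω, Real.exp (-(lam * A ω ^ 2)) ∂P - 1 + lam * ∫ ω, A ω ^ 2 ∂P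
        = ∫ ω, (Real.exp (-(lam * A ω ^ 2)) - 1 + lam * A ω ^ 2) ∂P := by
      have i1 : Integrable (fun ω => Real.exp (-(lam * A ω ^ 2)) - 1) P :=
        hexp.sub (integrable_const 1)
      rw [integral_add i1 (hint.const_mul _),
        integral_sub hexp (integrable_const 1), integral_const_mul]
      simp
    rw [e, ← integral_indicator hS, ← integral_const_mul, ← integral_const_mul,
      ← integral_add ((hint.indicator hS).const_mul _) (hint.const_mul _)]
    refine (abs_integral_le_integral_abs).trans (integral_mono
      ((hexp.sub (integrable_const 1)).add (hint.const_mul _)).abs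
      (((hint.indicator hS).const_mul _).add (hint.const_mul _)) fun ω => ?_)
    have hx : 0 ≤ lam * A ω ^ 2 := mul_nonneg hl (sq_nonneg _)
    by_cases hω : δ < |A ω|
    · rw [Set.indicator_of_mem (show ω ∈ {ω | δ < |A ω|} from hω)]
      refine (abs_exp_neg_sub_one_add_le_self hx).trans ?_
      have : 0 ≤ lam ^ 2 * δ ^ 2 * A ω ^ 2 := by positivity
      linarith
    · rw [Set.indicator_of_notMem (show ω ∉ {ω | δ < |A ω|} from hω)]
      refine (abs_exp_neg_sub_one_add_le_sq hx).trans ?_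
      have h2 : A ω ^ 2 ≤ δ ^ 2 := sq_le_sq' (by have := (abs_le.1 (not_lt.1 hω)).1; linarith)
        (abs_le.1 (not_lt.1 hω)).2
      have := mul_le_mul_of_nonneg_left h2 (by positivity : 0 ≤ lam ^ 2 * A ω ^ 2)
      nlinarith
  have h2 := abs_exp_neg_sub_one_add_le_sq (mul_nonneg hl hnn)
  rw [mul_pow] at h2
  rw [abs_le] at h1 h2 ⊢
  constructor <;> linarith

/-- Convergence in probability from convergence of two Laplace transforms. -/
lemma tendsto_measureReal_of_tendsto_integral_exp {S : ℕ → Ω → ℝ} (hS : ∀ n, Measurable (S n))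
    (hS0 : ∀ n ω, 0 ≤ S n ω) {s : ℕ → ℝ} {B : ℝ} (hs0 : ∀ n, 0 ≤ s n) (hs : ∀ᶠ n in atTop, s n ≤ B)
    (h : ∀ lam : ℝ, 0 < lam → Tendsto (fun n => ∫ ω, Real.exp (-(lam * S n ω)) ∂P
      - Real.exp (-(lam * s n))) atTop (𝓝 0)) {ε : ℝ} (hε : 0 < ε) :
    Tendsto (fun n => P.real {ω | ε ≤ |S n ω - s n|}) atTop (𝓝 0) := by
  have hint : ∀ (lam : ℝ), 0 < lam → ∀ n, Integrable (fun ω => Real.exp (-(lam * S n ω))) P := by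
    intro lam hl n
    refine Integrable.of_bound (by have := hS n; fun_prop) 1 (Eventually.of_forall fun ω => ?_)
    rw [Real.norm_of_nonneg (Real.exp_pos _).le]
    exact Real.exp_le_one_iff.2 (by have := mul_nonneg hl.le (hS0 n ω); linarith)
  -- The second moment of `exp (-S) - exp (-s)` involves the Laplace transform at 1 and 2 only.
  have hsq : ∀ n ω, (Real.exp (-S n ω) - Real.exp (-s n)) ^ 2
      = Real.exp (-(2 * S n ω)) - 2 * Real.exp (-s n) * Real.exp (-(1 * S n ω))
        + Real.exp (-(2 * s n)) := by
    intro n ω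
    have e1 : Real.exp (-(2 * S n ω)) = Real.exp (-S n ω) ^ 2 := by
      rw [← Real.exp_nat_mul]; push_cast; ring_nf
    have e2 : Real.exp (-(2 * s n)) = Real.exp (-s n) ^ 2 := by
      rw [← Real.exp_nat_mul]; push_cast; ring_nf
    rw [e1, e2, one_mul]
    ring
  have hI : ∀ n, Integrable (fun ω => (Real.exp (-S n ω) - Real.exp (-s n)) ^ 2) P := by
    intro n
    simp_rw [hsq]
    exact ((hint 2 two_pos n).sub ((hint 1 one_pos n).const_mul _)).add (integrable_const _)
  have hlim : Tendsto (fun n => ∫ ω, (Real.exp (-S n ω) - Real.exp (-s n)) ^ 2 ∂P) atTop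
      (𝓝 0) := by
    have e : ∀ n, ∫ ω, (Real.exp (-S n ω) - Real.exp (-s n)) ^ 2 ∂P
        = (∫ ω, Real.exp (-(2 * S n ω)) ∂P - Real.exp (-(2 * s n)))
          - 2 * (Real.exp (-s n) * (∫ ω, Real.exp (-(1 * S n ω)) ∂P - Real.exp (-(1 * s n)))) := by
      intro n
      simp_rw [hsq]
      have i1 : Integrable (fun ω => Real.exp (-(2 * S n ω))
          - 2 * Real.exp (-s n) * Real.exp (-(1 * S n ω))) P :=
        (hint 2 two_pos n).sub ((hint 1 one_pos n).const_mul _)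
      rw [integral_add i1 (integrable_const _), integral_sub (hint 2 two_pos n) ((hint 1 one_pos n).const_mul _),
        integral_const_mul]
      have e2 : Real.exp (-(2 * s n)) = Real.exp (-s n) * Real.exp (-s n) := by
        rw [← Real.exp_add]; ring_nf
      simp only [integral_const, probReal_univ, smul_eq_mul, one_mul]
      rw [e2]
      ring
    simp_rw [e]
    have h1 : Tendsto (fun n => Real.exp (-s n) * (∫ ω, Real.exp (-(1 * S n ω)) ∂P
        - Real.exp (-(1 * s n)))) atTop (𝓝 0) := by
      refine squeeze_zero_norm (a := fun n => ‖∫ ω, Real.exp (-(1 * S n ω)) ∂P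
        - Real.exp (-(1 * s n))‖) (fun n => ?_) (by simpa only [norm_zero] using (h 1 one_pos).norm)
      have : Real.exp (-s n) ≤ 1 := Real.exp_le_one_iff.2 (by have := hs0 n; linarith)
      rw [norm_mul, Real.norm_of_nonneg (Real.exp_pos _).le]
      exact mul_le_of_le_one_left (norm_nonneg _) this
    simpa using (h 2 two_pos).sub (h1.const_mul 2)
  -- A lower bound for `|exp (-S) - exp (-s)|` where `|S - s| ≥ ε` and `s ≤ B`: factor out `exp (-s)
  -- ≥ exp (-B)`, and use `exp ε - 1 ≥ ε ≥ 1 - exp (-ε)` when `S` is the smaller one. Markov's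
  -- inequality then concludes.
  set κ := Real.exp (-B) * (1 - Real.exp (-ε)) with hκ
  have hκ0 : 0 < κ := mul_pos (Real.exp_pos _) (by
    have : Real.exp (-ε) < 1 := Real.exp_lt_one_iff.2 (by linarith)
    linarith)
  refine squeeze_zero' (Eventually.of_forall fun n => measureReal_nonneg) ?_
    (by simpa using hlim.div_const (κ ^ 2))
  filter_upwards [hs] with n hn
  rw [le_div_iff₀ (by positivity), mul_comm]
  refine le_trans ?_ (mul_meas_ge_le_integral_of_nonneg
    (Eventually.of_forall fun ω => sq_nonneg _) (hI n) (κ ^ 2))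
  refine mul_le_mul_of_nonneg_left (measureReal_mono fun ω hω => ?_) (by positivity)
  simp only [Set.mem_ofPred_eq] at hω ⊢
  have hB : Real.exp (-B) ≤ Real.exp (-s n) := Real.exp_le_exp.2 (by linarith)
  have hfac : Real.exp (-S n ω) = Real.exp (-s n) * Real.exp (-(S n ω - s n)) := by
    rw [← Real.exp_add]; ring_nf
  have hx : 1 - Real.exp (-ε) ≤ |Real.exp (-(S n ω - s n)) - 1| := by
    rcases le_abs'.1 hω with h | h
    · have h1 : Real.exp ε ≤ Real.exp (-(S n ω - s n)) := Real.exp_le_exp.2 (by linarith)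
      have h2 := Real.add_one_le_exp ε
      have h3 := Real.add_one_le_exp (-ε)
      refine le_trans ?_ (le_abs_self _)
      linarith
    · have h1 : Real.exp (-(S n ω - s n)) ≤ Real.exp (-ε) := Real.exp_le_exp.2 (by linarith)
      refine le_trans ?_ (neg_le_abs _)
      linarith
  have : κ ≤ |Real.exp (-S n ω) - Real.exp (-s n)| := by
    rw [hfac, show ∀ a b : ℝ, a * b - a = a * (b - 1) from fun a b => by ring, abs_mul,
      abs_of_pos (Real.exp_pos _)]
    have h1 : Real.exp (-ε) < 1 := Real.exp_lt_one_iff.2 (by linarith)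
    exact mul_le_mul hB hx (by linarith) (Real.exp_pos _).le
  calc κ ^ 2 ≤ |Real.exp (-S n ω) - Real.exp (-s n)| ^ 2 := by gcongr
    _ = _ := sq_abs _

end Laplace

/-! ### Weak law for sums of squares over blocks, and negligibility of the largest block. -/

section BlockSums

lemma abs_pow_sub_pow_le_mul {a b : ℝ} (ha : 0 ≤ a) (ha1 : a ≤ 1) (hb : 0 ≤ b) (hb1 : b ≤ 1)
    (n : ℕ) : |a ^ n - b ^ n| ≤ n * |a - b| := by
  induction n with
  | zero => simp
  | succ n ih =>
    have e : a ^ (n + 1) - b ^ (n + 1) = (a ^ n - b ^ n) * a + b ^ n * (a - b) := by ring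
    rw [e]
    refine (abs_add_le _ _).trans ?_
    rw [abs_mul, abs_mul, abs_of_nonneg ha, abs_of_nonneg (pow_nonneg hb n)]
    have h1 := mul_le_of_le_one_right (abs_nonneg (a ^ n - b ^ n)) ha1
    have h2 := mul_le_of_le_one_left (abs_nonneg (a - b)) (pow_le_one₀ hb hb1 (n := n))
    push_cast
    linarith

lemma sum_range_eq_sum_even_add_sum_odd {M : Type*} [AddCommMonoid M] (a : ℕ → M) (m : ℕ) :
    ∑ j ∈ Finset.range m, a j = ∑ i ∈ Finset.range ((m + 1) / 2), a (2 * i)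
      + ∑ i ∈ Finset.range (m / 2), a (2 * i + 1) := by
  induction m with
  | zero => simp
  | succ m ih =>
    rw [Finset.sum_range_succ, ih]
    obtain ⟨q, rfl | rfl⟩ := m.even_or_odd'
    · have h1 : (2 * q + 1) / 2 = q := by omega
      have h2 : (2 * q + 1 + 1) / 2 = q + 1 := by omega
      have h3 : 2 * q / 2 = q := by omega
      rw [h1, h2, h3, Finset.sum_range_succ (fun i => a (2 * i))]
      abel
    · have h1 : (2 * q + 1) / 2 = q := by omega
      have h2 : (2 * q + 1 + 1) / 2 = q + 1 := by omega
      have h3 : (2 * q + 1 + 1 + 1) / 2 = q + 1 := by omega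
      rw [h1, h2, h3, Finset.sum_range_succ (fun i => a (2 * i + 1))]
      abel

variable {Ω : Type*} [MeasurableSpace Ω] {P : Measure Ω} [IsProbabilityMeasure P] {d : ℕ}
  {X : ℕ → ℕ → Ω → (Fin d → ℝ)}

/-- A weak law of large numbers for squares of functions of every second block. -/
lemma tendsto_measureReal_sum_sq_alternate_blocks (hX : ∀ n i : ℕ, i < n → Measurable (X n i))
    (hs : RowwiseStationary P X) {r ℓ : ℕ → ℕ} (hr : ∀ᶠ n in atTop, 1 ≤ r n)
    (hk : ∀ᶠ n in atTop, ℓ n ≤ r n) (hm : Tendsto (fun n => n / r n) atTop atTop)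
    (hβ : Tendsto (fun n => ((n / r n : ℕ) : ℝ) * betaCoeff P X n (ℓ n)) atTop (𝓝 0))
    {H : ∀ n, (Fin (r n) → (Fin d → ℝ)) → ℝ} (hH : ∀ n, Measurable (H n))
    (hint : ∀ᶠ n in atTop, Integrable (fun ω => H n (segment X n 0 (r n) ω) ^ 2) P) {B : ℝ}
    (hB : ∀ᶠ n in atTop, ((n / r n : ℕ) : ℝ) * ∫ ω, H n (segment X n 0 (r n) ω) ^ 2 ∂P ≤ B)
    (hlin : ∀ δ > 0, Tendsto (fun n => ((n / r n : ℕ) : ℝ) *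
      ∫ ω in {ω | δ < |H n (segment X n 0 (r n) ω)|}, H n (segment X n 0 (r n) ω) ^ 2 ∂P)
      atTop (𝓝 0))
    (p : ℕ) (K : ℕ → ℕ) (hK : ∀ n, 2 * K n + p ≤ n / r n + 1) {ε : ℝ} (hε : 0 < ε) :
    Tendsto (fun n => P.real {ω | ε ≤ |∑ i ∈ Finset.range (K n),
        H n (segment X n ((2 * i + p) * r n) (r n) ω) ^ 2
      - K n * ∫ ω, H n (segment X n 0 (r n) ω) ^ 2 ∂P|}) atTop (𝓝 0) := by
  have hle : ∀ n i, i < K n → (2 * i + p) * r n + r n ≤ n := by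
    intro n i hi
    have h1 : (2 * i + p + 1) * r n ≤ n / r n * r n :=
      Nat.mul_le_mul_right _ (by have := hK n; omega)
    rw [add_mul, one_mul] at h1
    exact h1.trans (Nat.div_mul_le_self n (r n))
  have hKm : ∀ n, (K n : ℝ) ≤ ((n / r n : ℕ) : ℝ) := fun n => by
    exact_mod_cast (show K n ≤ n / r n by
      have := hK n
      generalize n / r n = a at *
      omega)
  have hI0 : ∀ n, 0 ≤ ∫ ω, H n (segment X n 0 (r n) ω) ^ 2 ∂P :=
    fun n => integral_nonneg fun _ => sq_nonneg _
  refine tendsto_measureReal_of_tendsto_integral_exp (B := B)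
    (fun n => Finset.measurable_sum _ fun i hi =>
      ((hH n).comp (measurable_segment hX (hle n i (Finset.mem_range.1 hi)))).pow_const 2)
    (fun n ω => Finset.sum_nonneg fun _ _ => sq_nonneg _)
    (fun n => mul_nonneg (Nat.cast_nonneg _) (hI0 n)) ?_ ?_ hε
  · filter_upwards [hB] with n hn
    exact (mul_le_mul_of_nonneg_right (hKm n) (hI0 n)).trans hn
  intro lam hl
  rw [Metric.tendsto_nhds]
  intro η hη
  -- This is the only part of the final bound which does not vanish as `n → ∞`, so `δ` is fixed
  -- beforehand.
  obtain ⟨δ, hδ, hδη⟩ : ∃ δ : ℝ, 0 < δ ∧ lam ^ 2 * δ ^ 2 * |B| < η := by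
    refine ⟨√(η / (lam ^ 2 * |B| + 1)), by positivity, ?_⟩
    rw [Real.sq_sqrt (by positivity), mul_div_assoc', div_mul_eq_mul_div,
      div_lt_iff₀ (by positivity)]
    nlinarith
  have hinv : Tendsto (fun n => (((n / r n : ℕ) : ℝ))⁻¹) atTop (𝓝 0) :=
    tendsto_inv_atTop_zero.comp (tendsto_natCast_atTop_atTop.comp hm)
  have hbound : Tendsto (fun n => ((n / r n : ℕ) : ℝ) * betaCoeff P X n (ℓ n)
      + lam * (((n / r n : ℕ) : ℝ) *
        ∫ ω in {ω | δ < |H n (segment X n 0 (r n) ω)|}, H n (segment X n 0 (r n) ω) ^ 2 ∂P)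
      + lam ^ 2 * δ ^ 2 * |B| + lam ^ 2 * B ^ 2 * (((n / r n : ℕ) : ℝ))⁻¹) atTop
      (𝓝 (lam ^ 2 * δ ^ 2 * |B|)) := by
    simpa using ((hβ.add ((hlin δ hδ).const_mul lam)).add
      (tendsto_const_nhds (x := lam ^ 2 * δ ^ 2 * |B|))).add (hinv.const_mul (lam ^ 2 * B ^ 2))
  filter_upwards [hr, hk, hint, hB, hbound.eventually_lt_const hδη, hm.eventually_ge_atTop 1]
    with n hrn hkn hintn hBn hbn hmn
  rw [dist_zero_right, Real.norm_eq_abs]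
  refine lt_of_le_of_lt ?_ hbn
  set g : (Fin (r n) → (Fin d → ℝ)) → ℝ := fun x => Real.exp (-(lam * H n x ^ 2)) with hg
  have hgm : Measurable g := by have := hH n; fun_prop
  have g1 : ∀ x, g x ≤ 1 := fun x =>
    Real.exp_le_one_iff.2 (by have := mul_nonneg hl.le (sq_nonneg (H n x)); linarith)
  have h1 := abs_integral_prod_blocks_sub_le (P := P) (n := n) hX hs hrn hkn hgm
    (fun x => (Real.exp_pos _).le) g1 p (K n) (by
      have := Nat.mul_le_mul_right (r n) (hK n)
      rw [add_mul (n / r n), one_mul] at this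
      have := Nat.div_mul_le_self n (r n)
      omega)
  -- The Laplace transform of a sum of squares is a product of `[0,1]`-valued block functions, so
  -- the factorization applies although `H` is unbounded.
  have hprod : ∀ ω, ∏ i ∈ Finset.range (K n), g (segment X n ((2 * i + p) * r n) (r n) ω)
      = Real.exp (-(lam * ∑ i ∈ Finset.range (K n),
        H n (segment X n ((2 * i + p) * r n) (r n) ω) ^ 2)) := by
    intro ω
    rw [Finset.mul_sum, ← Finset.sum_neg_distrib, Real.exp_sum]
  simp_rw [hprod] at h1
  set I := ∫ ω, H n (segment X n 0 (r n) ω) ^ 2 ∂P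
  set T := ∫ ω in {ω | δ < |H n (segment X n 0 (r n) ω)|}, H n (segment X n 0 (r n) ω) ^ 2 ∂P
  have hT0 : 0 ≤ T := integral_nonneg fun _ => sq_nonneg _
  have hrn' : 0 + r n ≤ n := by
    have := Nat.div_mul_le_self n (r n)
    have := Nat.mul_le_mul_right (r n) hmn
    omega
  have h2 := abs_integral_exp_neg_sq_sub_le (P := P)
    ((hH n).comp (measurable_segment hX hrn')) hintn (δ := δ) hl.le
  have eg1 : ∫ ω, g (segment X n 0 (r n) ω) ∂P ≤ 1 := by
    refine (integral_mono_of_nonneg (Eventually.of_forall fun _ => (Real.exp_pos _).le)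
      (integrable_const 1) (Eventually.of_forall fun _ => g1 _)).trans_eq ?_
    rw [integral_const, probReal_univ, one_smul]
  have h3 := abs_pow_sub_pow_le_mul (integral_nonneg fun ω => (Real.exp_pos _).le) eg1
    (Real.exp_pos (-(lam * I))).le
    (Real.exp_le_one_iff.2 (by have := mul_nonneg hl.le (hI0 n); linarith)) (K n)
  have hexp : Real.exp (-(lam * I)) ^ K n = Real.exp (-(lam * (K n * I))) := by
    rw [← Real.exp_nat_mul]; ring_nf
  rw [hexp] at h3
  set m : ℝ := ((n / r n : ℕ) : ℝ)
  have hm0 : 0 < m := Nat.cast_pos.2 hmn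
  have hβ0 := betaCoeff_nonneg (P := P) (X := X) n (ℓ n)
  have hI2 : m * I ^ 2 ≤ B ^ 2 * m⁻¹ := by
    rw [← div_eq_mul_inv, le_div_iff₀ hm0]
    have : (m * I) ^ 2 ≤ B ^ 2 := pow_le_pow_left₀ (mul_nonneg hm0.le (hI0 n)) hBn 2
    nlinarith
  calc |∫ ω, Real.exp (-(lam * ∑ i ∈ Finset.range (K n),
          H n (segment X n ((2 * i + p) * r n) (r n) ω) ^ 2)) ∂P - Real.exp (-(lam * (K n * I)))|
      ≤ K n * betaCoeff P X n (ℓ n) + K n * (lam * T + lam ^ 2 * δ ^ 2 * I + lam ^ 2 * I ^ 2) := by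
        refine (abs_sub_le _ _ _).trans (add_le_add h1 (h3.trans ?_))
        exact mul_le_mul_of_nonneg_left h2 (Nat.cast_nonneg _)
    _ ≤ m * betaCoeff P X n (ℓ n) + m * (lam * T + lam ^ 2 * δ ^ 2 * I + lam ^ 2 * I ^ 2) := by
        have := hI0 n
        have := hKm n
        gcongr
    _ = m * betaCoeff P X n (ℓ n) + lam * (m * T) + lam ^ 2 * δ ^ 2 * (m * I)
          + lam ^ 2 * (m * I ^ 2) := by ring
    _ ≤ m * betaCoeff P X n (ℓ n) + lam * (m * T) + lam ^ 2 * δ ^ 2 * |B|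
          + lam ^ 2 * (B ^ 2 * m⁻¹) := by
        have := hBn.trans (le_abs_self B)
        gcongr
    _ = _ := by ring

/-- The even and the odd blocks each obey the weak law, and their numbers add up to `m_n`. The two
fluctuations and the error in the centring are each below `ε / 4` off the exceptional events, for
large `n`. -/
lemma tendsto_measureReal_sum_sq_blocks (hX : ∀ n i : ℕ, i < n → Measurable (X n i))
    (hs : RowwiseStationary P X) {r ℓ : ℕ → ℕ} (hr : ∀ᶠ n in atTop, 1 ≤ r n)
    (hk : ∀ᶠ n in atTop, ℓ n ≤ r n) (hm : Tendsto (fun n => n / r n) atTop atTop)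
    (hβ : Tendsto (fun n => ((n / r n : ℕ) : ℝ) * betaCoeff P X n (ℓ n)) atTop (𝓝 0))
    {H : ∀ n, (Fin (r n) → (Fin d → ℝ)) → ℝ} (hH : ∀ n, Measurable (H n))
    (hint : ∀ᶠ n in atTop, Integrable (fun ω => H n (segment X n 0 (r n) ω) ^ 2) P) {v : ℝ}
    (hv : Tendsto (fun n => ((n / r n : ℕ) : ℝ) * ∫ ω, H n (segment X n 0 (r n) ω) ^ 2 ∂P) atTop
      (𝓝 v))
    (hlin : ∀ δ > 0, Tendsto (fun n => ((n / r n : ℕ) : ℝ) *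
      ∫ ω in {ω | δ < |H n (segment X n 0 (r n) ω)|}, H n (segment X n 0 (r n) ω) ^ 2 ∂P)
      atTop (𝓝 0)) {ε : ℝ} (hε : 0 < ε) :
    Tendsto (fun n => P.real {ω | ε ≤ |∑ j ∈ Finset.range (n / r n),
        H n (segment X n (j * r n) (r n) ω) ^ 2 - v|}) atTop (𝓝 0) := by
  have hB := hv.eventually_le_const (show v < v + 1 by simp)
  have h0 := tendsto_measureReal_sum_sq_alternate_blocks hX hs hr hk hm hβ hH hint hB hlin 0
    (fun n => (n / r n + 1) / 2) (fun n => by omega) (show 0 < ε / 4 by positivity)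
  have h1 := tendsto_measureReal_sum_sq_alternate_blocks hX hs hr hk hm hβ hH hint hB hlin 1
    (fun n => (n / r n) / 2) (fun n => by omega) (show 0 < ε / 4 by positivity)
  have hadd := h0.add h1
  rw [add_zero] at hadd
  refine squeeze_zero' (Eventually.of_forall fun n => measureReal_nonneg) ?_ hadd
  filter_upwards [(tendsto_iff_norm_sub_tendsto_zero.1 hv).eventually_lt_const
    (show 0 < ε / 4 by positivity)] with n hn
  refine le_trans (measureReal_mono fun ω hω => ?_) (measureReal_union_le _ _)
  simp only [Set.mem_ofPred_eq, Set.mem_union, add_zero] at hω ⊢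
  by_contra! hcon
  obtain ⟨c0, c1⟩ := hcon
  rw [sum_range_eq_sum_even_add_sum_odd
    (fun j => H n (segment X n (j * r n) (r n) ω) ^ 2)] at hω
  rw [Real.norm_eq_abs] at hn
  have hcast : ((n / r n : ℕ) : ℝ) = (((n / r n + 1) / 2 : ℕ) : ℝ) + (((n / r n) / 2 : ℕ) : ℝ) := by
    rw [← Nat.cast_add]
    congr 1
    omega
  rw [hcast, add_mul] at hn
  rw [abs_lt] at c0 c1 hn
  rcases le_abs'.1 hω with h | h <;> linarith

/-- Union bound: by stationarity each block contributes the same probability, at most `δ⁻²` times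
the truncated second moment by Chebyshev's inequality. The dependence between blocks plays no role.
-/
lemma tendsto_measureReal_exists_lt_abs_blocks (hX : ∀ n i : ℕ, i < n → Measurable (X n i))
    (hs : RowwiseStationary P X) {r : ℕ → ℕ}
    {H : ∀ n, (Fin (r n) → (Fin d → ℝ)) → ℝ} (hH : ∀ n, Measurable (H n))
    (hint : ∀ᶠ n in atTop, Integrable (fun ω => H n (segment X n 0 (r n) ω) ^ 2) P)
    {δ : ℝ} (hδ : 0 < δ)
    (hlin : Tendsto (fun n => ((n / r n : ℕ) : ℝ) *
      ∫ ω in {ω | δ < |H n (segment X n 0 (r n) ω)|}, H n (segment X n 0 (r n) ω) ^ 2 ∂P)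
      atTop (𝓝 0)) :
    Tendsto (fun n => P.real {ω | ∃ j < n / r n, δ < |H n (segment X n (j * r n) (r n) ω)|})
      atTop (𝓝 0) := by
  refine squeeze_zero' (Eventually.of_forall fun n => measureReal_nonneg) ?_
    (by simpa using hlin.div_const (δ ^ 2))
  filter_upwards [hint] with n hn
  have hle : ∀ j < n / r n, j * r n + r n ≤ n := by
    intro j hj
    have h1 : (j + 1) * r n ≤ n / r n * r n := Nat.mul_le_mul_right _ hj
    rw [add_mul, one_mul] at h1
    exact h1.trans (Nat.div_mul_le_self n (r n))
  have hset : MeasurableSet {x | δ < |H n x|} := measurableSet_lt measurable_const (hH n).abs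
  have hu : {ω | ∃ j < n / r n, δ < |H n (segment X n (j * r n) (r n) ω)|}
      = ⋃ j ∈ Finset.range (n / r n), {ω | δ < |H n (segment X n (j * r n) (r n) ω)|} := by
    ext ω; simp
  rw [hu]
  refine (measureReal_biUnion_finset_le _ _).trans ?_
  have hst : ∀ j ∈ Finset.range (n / r n), P.real {ω | δ < |H n (segment X n (j * r n) (r n) ω)|}
      ≤ (∫ ω in {ω | δ < |H n (segment X n 0 (r n) ω)|}, H n (segment X n 0 (r n) ω) ^ 2 ∂P)
        / δ ^ 2 := by
    intro j hj
    have hj := hle j (Finset.mem_range.1 hj)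
    have m0 : Measurable (segment X n 0 (r n)) := measurable_segment hX (by omega)
    have e : P.real {ω | δ < |H n (segment X n (j * r n) (r n) ω)|}
        = P.real {ω | δ < |H n (segment X n 0 (r n) ω)|} := by
      have := congrArg (fun μ => μ.real {x | δ < |H n x|}) (hs n (j * r n) (r n) hj)
      simp only [map_measureReal_apply (measurable_segment hX hj) hset,
        map_measureReal_apply m0 hset] at this
      exact this
    have hA : MeasurableSet {ω | δ < |H n (segment X n 0 (r n) ω)|} := m0 hset
    rw [e, le_div_iff₀ (by positivity)]
    have := setIntegral_mono_on (μ := P) (f := fun _ => δ ^ 2)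
      (g := fun ω => H n (segment X n 0 (r n) ω) ^ 2) (integrable_const _).integrableOn
      hn.integrableOn hA (fun ω hω => by
        rw [← sq_abs (H n _)]
        exact pow_le_pow_left₀ hδ.le (le_of_lt hω) 2)
    simpa using this
  refine (Finset.sum_le_sum hst).trans (le_of_eq ?_)
  rw [Finset.sum_const, Finset.card_range, nsmul_eq_mul, mul_div_assoc]

end BlockSums

/-! ### Conditional laws under independence. -/

section Conditioning

/-- The conditional distribution of a function of two independent random elements, given the
first one. -/
lemma condDistrib_comp_prodMk_of_indepFun {Ω α β γ : Type*} [MeasurableSpace Ω] [MeasurableSpace α]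
    [MeasurableSpace β] [MeasurableSpace γ] [StandardBorelSpace γ] [Nonempty γ] {P : Measure Ω}
    [IsProbabilityMeasure P] {X : Ω → α} {Y : Ω → β} (hX : Measurable X) (hY : Measurable Y)
    (h : IndepFun X Y P) {Φ : α × β → γ} (hΦ : Measurable Φ) :
    ∀ᵐ ω ∂P, condDistrib (fun ω' => Φ (X ω', Y ω')) X P (X ω)
      = P.map fun ω' => Φ (X ω, Y ω') := by
  have hp := Measure.isProbabilityMeasure_map (μ := P) hY.aemeasurable
  -- The candidate freezes `X` at `x` and draws `Y` from its own law. By independence it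
  -- disintegrates the joint law, and conditional distributions are almost everywhere unique.
  let κ : Kernel α γ := (Kernel.id ×ₖ Kernel.const α (P.map Y)).map Φ
  have hκ : ∀ x, κ x = P.map fun ω' => Φ (x, Y ω') := by
    intro x
    rw [Kernel.map_apply _ hΦ, Kernel.prod_apply, Kernel.id_apply, Kernel.const_apply,
      Measure.dirac_prod, Measure.map_map hΦ measurable_prodMk_left,
      Measure.map_map (hΦ.comp measurable_prodMk_left) hY]
    rfl
  have hmark : IsMarkovKernel κ := Kernel.IsMarkovKernel.map _ hΦ
  have key : condDistrib (fun ω' => Φ (X ω', Y ω')) X P =ᵐ[P.map X] κ := by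
    refine condDistrib_ae_eq_of_measure_eq_compProd X (by fun_prop) ?_
    refine Measure.ext_of_lintegral _ fun f hf => ?_
    have hpair : Measurable fun ω => (X ω, Φ (X ω, Y ω)) := by fun_prop
    have hf2 : Measurable fun p : α × β => f (p.1, Φ p) := by fun_prop
    rw [lintegral_map hf hpair, Measure.lintegral_compProd hf]
    have e : ∀ x, ∫⁻ z, f (x, z) ∂(κ x) = ∫⁻ y, f (x, Φ (x, y)) ∂(P.map Y) := by
      intro x
      rw [hκ, lintegral_map (by fun_prop) (by fun_prop), lintegral_map (by fun_prop) hY]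
    simp_rw [e]
    have hX' := Measure.isProbabilityMeasure_map (μ := P) hX.aemeasurable
    rw [← lintegral_prod (fun p : α × β => f (p.1, Φ p)) hf2.aemeasurable,
      ← (indepFun_iff_map_prod_eq_prod_map_map hX.aemeasurable hY.aemeasurable).1 h,
      lintegral_map hf2 (hX.prodMk hY)]
  filter_upwards [ae_of_ae_map hX.aemeasurable key] with ω hω
  rw [hω, hκ]

end Conditioning

/-! ### Standardized block values and their limiting moments. -/

section Standardized

variable {Ω : Type*} [MeasurableSpace Ω] {P : Measure Ω} {d : ℕ}
  {X : ℕ → ℕ → Ω → (Fin d → ℝ)} {r ℓ : ℕ → ℕ} {F : Set (EUnion d → ℝ)} {c : F → F → ℝ}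

/-- The value `(f(y) - E f(Y_n)) / √(n v_n)` of the standardized cluster functional, as a function
of a vector `y` of length `r_n`. -/
noncomputable def standardized (P : Measure Ω) (X : ℕ → ℕ → Ω → (Fin d → ℝ)) (r : ℕ → ℕ)
    (f : EUnion d → ℝ) (n : ℕ) (y : Fin (r n) → (Fin d → ℝ)) : ℝ :=
  (f ⟨r n, y⟩ - ∫ ω, f (block X r n 0 ω) ∂P) / √((n : ℝ) * exceedProb P X n)

lemma measurable_EUnion_mk (l : ℕ) : Measurable fun y : Fin l → (Fin d → ℝ) => (⟨l, y⟩ : EUnion d) := by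
  intro s hs
  exact (MeasurableSpace.measurableSet_iInf.1 hs) l

lemma measurable_standardized {f : EUnion d → ℝ} (hf : Measurable f) (n : ℕ) :
    Measurable (standardized P X r f n) :=
  ((hf.comp (measurable_EUnion_mk _)).sub_const _).div_const _

lemma block_zero {Ω : Type*} (X : ℕ → ℕ → Ω → (Fin d → ℝ)) (r : ℕ → ℕ) (n : ℕ) (ω : Ω) :
    block X r n 0 ω = ⟨r n, segment X n 0 (r n) ω⟩ := by
  rw [block, zero_mul]

lemma standardized_segment_zero (f : EUnion d → ℝ) (n : ℕ) (ω : Ω) :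
    standardized P X r f n (segment X n 0 (r n) ω)
      = (f (block X r n 0 ω) - ∫ ω', f (block X r n 0 ω') ∂P) / √((n : ℝ) * exceedProb P X n) := by
  rw [standardized, ← block_zero]

lemma mul_add_le_of_lt_div {n r j : ℕ} (hj : j < n / r) : j * r + r ≤ n := by
  have h1 : (j + 1) * r ≤ n / r * r := Nat.mul_le_mul_right _ hj
  rw [add_mul, one_mul] at h1
  exact h1.trans (Nat.div_mul_le_self n r)

lemma multiplierProcess_eq_sum_standardized (hX : ∀ n i : ℕ, i < n → Measurable (X n i))
    (hs : RowwiseStationary P X) (ξ : ℕ → Ω → ℝ) {f : EUnion d → ℝ} (hf : Measurable f) (n : ℕ)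
    (ω : Ω) : multiplierProcess P X r ξ n f ω = ∑ j ∈ Finset.range (n / r n),
      ξ j ω * standardized P X r f n (segment X n (j * r n) (r n) ω) := by
  rw [multiplierProcess, Finset.mul_sum]
  refine Finset.sum_congr rfl fun j hj => ?_
  have hj := mul_add_le_of_lt_div (Finset.mem_range.1 hj)
  have e : ∫ ω', f (block X r n j ω') ∂P = ∫ ω', f (block X r n 0 ω') ∂P := by
    simp_rw [block_zero]
    exact integral_comp_segment hX hs hj (g := fun y => f ⟨r n, y⟩) (hf.comp (measurable_EUnion_mk _))
  rw [e, standardized, block]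
  ring

lemma CondB1.eventually_ell_le (h1 : CondB1 P X r ℓ) : ∀ᶠ n in atTop, ℓ n ≤ r n := by
  filter_upwards [h1.ell_littleO.bound one_pos] with n hn
  simpa using hn

lemma CondB1.eventually_one_le (h1 : CondB1 P X r ℓ) : ∀ᶠ n in atTop, 1 ≤ r n := by
  filter_upwards [h1.eventually_ell_le, h1.ell_tendsto.eventually_ge_atTop 1] with n a b
  omega

lemma CondB1.tendsto_div (h1 : CondB1 P X r ℓ) : Tendsto (fun n => n / r n) atTop atTop := by
  refine tendsto_atTop.2 fun b => ?_
  filter_upwards [h1.r_littleO.bound (c := 1 / ((b : ℝ) + 1)) (by positivity),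
    h1.eventually_one_le] with n hn hr
  rw [Nat.le_div_iff_mul_le hr]
  simp only [Real.norm_natCast] at hn
  rw [one_div_mul_eq_div, le_div_iff₀ (by positivity)] at hn
  have : (b : ℝ) * r n ≤ n := by nlinarith [(Nat.cast_nonneg (r n) : (0 : ℝ) ≤ r n)]
  exact_mod_cast this

/-- Since `m_n / (n v_n) = (m_n r_n / n) / (r_n v_n)`, this converts the normalization `r_n v_n` of
the moment conditions into sums over `m_n` standardized blocks. -/
lemma CondB1.tendsto_ratio (h1 : CondB1 P X r ℓ) :
    Tendsto (fun n => ((n / r n : ℕ) : ℝ) * r n / n) atTop (𝓝 1) := by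
  have h0 := h1.r_littleO.tendsto_div_nhds_zero
  refine tendsto_of_tendsto_of_tendsto_of_le_of_le' (by simpa using h0.const_sub 1)
    tendsto_const_nhds ?_ ?_
  · filter_upwards [eventually_ge_atTop 1, h1.eventually_one_le] with n hn hr
    have hn' : (0 : ℝ) < n := Nat.cast_pos.2 hn
    rw [one_sub_div hn'.ne']
    gcongr
    have := Nat.lt_div_mul_add (a := n) (b := r n) hr
    have : (n : ℝ) < ((n / r n : ℕ) : ℝ) * r n + r n := by exact_mod_cast this
    linarith
  · filter_upwards with n
    refine div_le_one_of_le₀ ?_ (Nat.cast_nonneg n)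
    exact_mod_cast Nat.div_mul_le_self n (r n)

lemma CondB2.tendsto_mul_betaCoeff (h2 : CondB2 P X r ℓ) :
    Tendsto (fun n => ((n / r n : ℕ) : ℝ) * betaCoeff P X n (ℓ n)) atTop (𝓝 0) := by
  refine squeeze_zero (fun n => mul_nonneg (Nat.cast_nonneg _) (betaCoeff_nonneg _ _))
    (fun n => ?_) h2
  rw [mul_comm, mul_div_assoc]
  exact mul_le_mul_of_nonneg_left Nat.cast_div_le (betaCoeff_nonneg _ _)

lemma tendsto_mul_integral_standardized (h1 : CondB1 P X r ℓ) (h3 : CondC3 P X r F c) (f g : F) :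
    Tendsto (fun n => ((n / r n : ℕ) : ℝ) *
      ∫ ω, standardized P X r f.1 n (segment X n 0 (r n) ω)
        * standardized P X r g.1 n (segment X n 0 (r n) ω) ∂P) atTop (𝓝 (c f g)) := by
  have := h1.tendsto_ratio.mul (h3 f g)
  rw [one_mul] at this
  refine this.congr' ?_
  filter_upwards [h1.eventually_one_le] with n hr
  have hr' : (r n : ℝ) ≠ 0 := by positivity
  have hnv : 0 ≤ (n : ℝ) * exceedProb P X n := mul_nonneg (Nat.cast_nonneg _) measureReal_nonneg
  simp_rw [standardized_segment_zero, div_mul_div_comm, Real.mul_self_sqrt hnv]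
  rw [integral_div, covariance]
  set I := ∫ ω, (f.1 (block X r n 0 ω) - ∫ ω', f.1 (block X r n 0 ω') ∂P)
    * (g.1 (block X r n 0 ω) - ∫ ω', g.1 (block X r n 0 ω') ∂P) ∂P
  field_simp

lemma eventually_memLp_standardized [IsProbabilityMeasure P] (h2 : CondC2 P X r F) (f : F) :
    ∀ᶠ n in atTop, MemLp (fun ω => standardized P X r f.1 n (segment X n 0 (r n) ω)) 2 P := by
  filter_upwards [h2.memLp f.1 f.2] with n hn
  simp_rw [standardized_segment_zero, div_eq_mul_inv]
  exact (hn.sub (memLp_const _)).mul_const _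

lemma tendsto_mul_setIntegral_standardized (h1 : CondB1 P X r ℓ) (h2 : CondC2 P X r F) (f : F)
    {δ : ℝ} (hδ : 0 < δ) :
    Tendsto (fun n => ((n / r n : ℕ) : ℝ) *
      ∫ ω in {ω | δ < |standardized P X r f.1 n (segment X n 0 (r n) ω)|},
        standardized P X r f.1 n (segment X n 0 (r n) ω) ^ 2 ∂P) atTop (𝓝 0) := by
  have := h1.tendsto_ratio.mul (h2.lindeberg δ hδ f.1 f.2).tendsto_div_nhds_zero
  rw [mul_zero] at this
  refine this.congr' ?_
  filter_upwards [h1.eventually_one_le, h1.nv_tendsto.eventually_gt_atTop 0] with n hr hnv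
  have hr' : (r n : ℝ) ≠ 0 := by positivity
  have hset : {ω | δ < |standardized P X r f.1 n (segment X n 0 (r n) ω)|}
      = {ω | δ * √((n : ℝ) * exceedProb P X n)
        < |f.1 (block X r n 0 ω) - ∫ ω', f.1 (block X r n 0 ω') ∂P|} := by
    ext ω
    simp only [Set.mem_ofPred_eq]
    rw [standardized_segment_zero, abs_div, abs_of_pos (Real.sqrt_pos.2 hnv),
      lt_div_iff₀ (Real.sqrt_pos.2 hnv)]
  rw [hset]
  simp_rw [standardized_segment_zero, div_pow, Real.sq_sqrt hnv.le]
  rw [integral_div]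
  set I := ∫ ω in {ω | δ * √((n : ℝ) * exceedProb P X n)
        < |f.1 (block X r n 0 ω) - ∫ ω', f.1 (block X r n 0 ω') ∂P|},
    (f.1 (block X r n 0 ω) - ∫ ω', f.1 (block X r n 0 ω') ∂P) ^ 2 ∂P
  field_simp

/-- The quadratic form is the limit of nonnegative multiples of variances of linear combinations;
symmetry follows from uniqueness of limits. -/
lemma posSemidef_of_tendsto_cov [IsProbabilityMeasure P] (h2 : CondC2 P X r F)
    (h3 : CondC3 P X r F c) {l : ℕ} (f : Fin l → F) :
    (Matrix.of fun i j => c (f i) (f j)).PosSemidef := by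
  refine Matrix.PosSemidef.of_dotProduct_mulVec_nonneg ?_ fun x => ?_
  · ext i j
    simp only [Matrix.conjTranspose_apply, Matrix.of_apply, star_trivial]
    refine tendsto_nhds_unique (h3 (f j) (f i)) ((h3 (f i) (f j)).congr fun n => ?_)
    rw [covariance_comm]
  · have hlim : Tendsto (fun n => ∑ i, ∑ j, x i * (1 / ((r n : ℝ) * exceedProb P X n) *
        cov[fun ω => (f i).1 (block X r n 0 ω), fun ω => (f j).1 (block X r n 0 ω); P] * x j))
        atTop (𝓝 (∑ i, ∑ j, x i * (c (f i) (f j) * x j))) :=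
      tendsto_finsetSum _ fun i _ => tendsto_finsetSum _ fun j _ =>
        ((h3 (f i) (f j)).mul_const _).const_mul _
    have hex : star x ⬝ᵥ Matrix.mulVec (Matrix.of fun i j => c (f i) (f j)) x
        = ∑ i, ∑ j, x i * (c (f i) (f j) * x j) := by
      simp [dotProduct, Matrix.mulVec, Finset.mul_sum]
    rw [hex]
    refine ge_of_tendsto hlim ?_
    filter_upwards [eventually_all.2 fun i => h2.memLp (f i).1 (f i).2] with n hn
    have hvar : ∑ i, ∑ j, x i * (1 / ((r n : ℝ) * exceedProb P X n) *
        cov[fun ω => (f i).1 (block X r n 0 ω), fun ω => (f j).1 (block X r n 0 ω); P] * x j)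
        = 1 / ((r n : ℝ) * exceedProb P X n) *
          Var[fun ω => ∑ i, x i * (f i).1 (block X r n 0 ω); P] := by
      rw [variance_fun_sum fun i => (hn i).const_mul (x i), Finset.mul_sum]
      refine Finset.sum_congr rfl fun i _ => ?_
      rw [Finset.mul_sum]
      refine Finset.sum_congr rfl fun j _ => ?_
      rw [covariance_const_mul_left, covariance_const_mul_right]
      ring
    rw [hvar]
    exact mul_nonneg (one_div_nonneg.2 (mul_nonneg (Nat.cast_nonneg _) measureReal_nonneg))
      (variance_nonneg _ _)

end Standardized

/-! ### Conditional covariances and conditional law of the multiplier process. -/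

section Convergence

/-- Where `|a + b| > δ`, the larger of `|a|` and `|b|` exceeds `δ / 2`, and four times its square
dominates `(a + b)²`. Thus the Lindeberg condition passes to sums, as polarization requires. -/
lemma setIntegral_add_sq_le {Ω : Type*} [MeasurableSpace Ω] {P : Measure Ω} {a b : Ω → ℝ}
    (ha : Measurable a) (hb : Measurable b) (hia : Integrable (fun ω => a ω ^ 2) P)
    (hib : Integrable (fun ω => b ω ^ 2) P) (δ : ℝ) :
    ∫ ω in {ω | δ < |a ω + b ω|}, (a ω + b ω) ^ 2 ∂P
      ≤ 4 * ∫ ω in {ω | δ / 2 < |a ω|}, a ω ^ 2 ∂P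
        + 4 * ∫ ω in {ω | δ / 2 < |b ω|}, b ω ^ 2 ∂P := by
  have ma : MeasurableSet {ω | δ / 2 < |a ω|} := measurableSet_lt measurable_const ha.abs
  have mb : MeasurableSet {ω | δ / 2 < |b ω|} := measurableSet_lt measurable_const hb.abs
  have mab : MeasurableSet {ω | δ < |a ω + b ω|} :=
    measurableSet_lt measurable_const (ha.add hb).abs
  rw [← integral_indicator ma, ← integral_indicator mb, ← integral_indicator mab,
    ← integral_const_mul, ← integral_const_mul, ← integral_add ((hia.indicator ma).const_mul 4)
      ((hib.indicator mb).const_mul 4)]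
  refine integral_mono_of_nonneg
    (Eventually.of_forall fun ω => Set.indicator_nonneg (fun _ _ => sq_nonneg _) _)
    (((hia.indicator ma).const_mul 4).add ((hib.indicator mb).const_mul 4))
    (Eventually.of_forall fun ω => ?_)
  have h0a : 0 ≤ {ω | δ / 2 < |a ω|}.indicator (fun ω => a ω ^ 2) ω :=
    Set.indicator_nonneg (fun _ _ => sq_nonneg _) _
  have h0b : 0 ≤ {ω | δ / 2 < |b ω|}.indicator (fun ω => b ω ^ 2) ω :=
    Set.indicator_nonneg (fun _ _ => sq_nonneg _) _
  by_cases hω : δ < |a ω + b ω|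
  · rw [Set.indicator_of_mem (show ω ∈ {ω | δ < |a ω + b ω|} from hω)]
    have htri := abs_add_le (a ω) (b ω)
    beta_reduce
    rcases le_total |b ω| |a ω| with h | h
    · rw [Set.indicator_of_mem (show ω ∈ {ω | δ / 2 < |a ω|} by
        simp only [Set.mem_ofPred_eq]; linarith)]
      have : (a ω + b ω) ^ 2 ≤ 4 * a ω ^ 2 := by
        rw [← sq_abs (a ω + b ω), ← sq_abs (a ω)]
        nlinarith [abs_nonneg (a ω + b ω), abs_nonneg (a ω)]
      linarith
    · rw [Set.indicator_of_mem (show ω ∈ {ω | δ / 2 < |b ω|} by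
        simp only [Set.mem_ofPred_eq]; linarith)]
      have : (a ω + b ω) ^ 2 ≤ 4 * b ω ^ 2 := by
        rw [← sq_abs (a ω + b ω), ← sq_abs (b ω)]
        nlinarith [abs_nonneg (a ω + b ω), abs_nonneg (b ω)]
      linarith
  · rw [Set.indicator_of_notMem (show ω ∉ {ω | δ < |a ω + b ω|} from hω)]
    exact add_nonneg (mul_nonneg zero_le_four h0a) (mul_nonneg zero_le_four h0b)

lemma integral_add_sq {Ω : Type*} [MeasurableSpace Ω] {P : Measure Ω} {a b : Ω → ℝ}
    (ha : MemLp a 2 P) (hb : MemLp b 2 P) :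
    ∫ ω, (a ω + b ω) ^ 2 ∂P
      = ∫ ω, a ω * a ω ∂P + 2 * ∫ ω, a ω * b ω ∂P + ∫ ω, b ω * b ω ∂P := by
  have haa : Integrable (fun ω => a ω * a ω) P := ha.integrable_mul ha
  have hab : Integrable (fun ω => 2 * (a ω * b ω)) P := (ha.integrable_mul hb).const_mul 2
  have hbb : Integrable (fun ω => b ω * b ω) P := hb.integrable_mul hb
  have haab : Integrable (fun ω => a ω * a ω + 2 * (a ω * b ω)) P := haa.add hab
  rw [← integral_const_mul, ← integral_add haa hab, ← integral_add haab hbb]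
  exact integral_congr_ae (Eventually.of_forall fun ω => by ring)

variable {Ω : Type*} [MeasurableSpace Ω] {P : Measure Ω} [IsProbabilityMeasure P] {d : ℕ}
  {X : ℕ → ℕ → Ω → (Fin d → ℝ)} {r ℓ : ℕ → ℕ} {F : Set (EUnion d → ℝ)} {c : F → F → ℝ}

/-- Convergence in probability of the conditional covariances of the multiplier process. -/
lemma tendsto_measureReal_sum_mul_standardized (hX : ∀ n i : ℕ, i < n → Measurable (X n i))
    (hF : ∀ f ∈ F, IsClusterFunctional f) (hB1 : CondB1 P X r ℓ) (hB2 : CondB2 P X r ℓ)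
    (hC2 : CondC2 P X r F) (hC3 : CondC3 P X r F c) (f g : F) {ε : ℝ} (hε : 0 < ε) :
    Tendsto (fun n => P.real {ω | ε ≤ |∑ j ∈ Finset.range (n / r n),
      standardized P X r f.1 n (segment X n (j * r n) (r n) ω)
        * standardized P X r g.1 n (segment X n (j * r n) (r n) ω) - c f g|}) atTop (𝓝 0) := by
  have hmeas : ∀ (h : F) n, Measurable (standardized P X r h.1 n) :=
    fun h n => measurable_standardized (hF h.1 h.2).measurable n
  have hsq : ∀ h : F, ∀ᶠ n in atTop,
      Integrable (fun ω => standardized P X r h.1 n (segment X n 0 (r n) ω) ^ 2) P := fun h => by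
    filter_upwards [eventually_memLp_standardized hC2 h] with n hn using hn.integrable_sq
  have hsingle : ∀ h : F, Tendsto (fun n => P.real {ω | ε / 2 ≤ |∑ j ∈ Finset.range (n / r n),
      standardized P X r h.1 n (segment X n (j * r n) (r n) ω) ^ 2 - c h h|}) atTop (𝓝 0) :=
    fun h => tendsto_measureReal_sum_sq_blocks hX hB1.stationary hB1.eventually_one_le
      hB1.eventually_ell_le hB1.tendsto_div hB2.tendsto_mul_betaCoeff (hmeas h) (hsq h)
      (by simpa only [sq] using tendsto_mul_integral_standardized hB1 hC3 h h)
      (fun δ hδ => tendsto_mul_setIntegral_standardized hB1 hC2 h hδ) (by positivity)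
  have hsum : Tendsto (fun n => P.real {ω | ε / 2 ≤ |∑ j ∈ Finset.range (n / r n),
      (standardized P X r f.1 n (segment X n (j * r n) (r n) ω)
        + standardized P X r g.1 n (segment X n (j * r n) (r n) ω)) ^ 2
      - (c f f + 2 * c f g + c g g)|}) atTop (𝓝 0) := by
    refine tendsto_measureReal_sum_sq_blocks (H := fun n y => standardized P X r f.1 n y
      + standardized P X r g.1 n y) hX hB1.stationary hB1.eventually_one_le
      hB1.eventually_ell_le hB1.tendsto_div hB2.tendsto_mul_betaCoeff
      (fun n => (hmeas f n).add (hmeas g n)) ?_ ?_ (fun δ hδ => ?_) (by positivity)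
    · filter_upwards [eventually_memLp_standardized hC2 f, eventually_memLp_standardized hC2 g]
        with n hf hg using (hf.add hg).integrable_sq
    · refine (((tendsto_mul_integral_standardized hB1 hC3 f f).add
        ((tendsto_mul_integral_standardized hB1 hC3 f g).const_mul 2)).add
        (tendsto_mul_integral_standardized hB1 hC3 g g)).congr' ?_
      filter_upwards [eventually_memLp_standardized hC2 f, eventually_memLp_standardized hC2 g]
        with n hf hg
      rw [integral_add_sq hf hg]
      ring
    · have hlim := ((tendsto_mul_setIntegral_standardized hB1 hC2 f (half_pos hδ)).const_mul
        4).add ((tendsto_mul_setIntegral_standardized hB1 hC2 g (half_pos hδ)).const_mul 4)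
      simp only [mul_zero, add_zero] at hlim
      refine squeeze_zero' (Eventually.of_forall fun n => mul_nonneg (Nat.cast_nonneg _)
        (integral_nonneg fun _ => sq_nonneg _)) ?_ hlim
      filter_upwards [hsq f, hsq g, hB1.tendsto_div.eventually_ge_atTop 1] with n hf hg hn
      have hseg : Measurable (segment X n 0 (r n)) :=
        measurable_segment hX (by have := mul_add_le_of_lt_div hn; omega)
      have := mul_le_mul_of_nonneg_left (setIntegral_add_sq_le ((hmeas f n).comp hseg)
        ((hmeas g n).comp hseg) hf hg δ) (Nat.cast_nonneg (n / r n) : (0 : ℝ) ≤ _)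
      simp only [Function.comp_apply] at this
      linarith
  have hadd := (hsum.add (hsingle f)).add (hsingle g)
  simp only [add_zero] at hadd
  refine squeeze_zero (fun n => measureReal_nonneg) (fun n => ?_) hadd
  refine (measureReal_mono fun ω hω => ?_).trans
    ((measureReal_union_le _ _).trans (add_le_add_left (measureReal_union_le _ _) _))
  simp only [Set.mem_ofPred_eq, Set.mem_union] at hω ⊢
  -- Polarization `2ab = (a + b)² - a² - b²`: off the three events twice the error is below `3ε /
  -- 2`, yet it is at least `2ε`.
  by_contra! hcon
  obtain ⟨⟨h1, h2⟩, h3⟩ := hcon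
  have e : ∑ j ∈ Finset.range (n / r n),
      (standardized P X r f.1 n (segment X n (j * r n) (r n) ω)
        + standardized P X r g.1 n (segment X n (j * r n) (r n) ω)) ^ 2
      = ∑ j ∈ Finset.range (n / r n), standardized P X r f.1 n (segment X n (j * r n) (r n) ω) ^ 2
        + 2 * ∑ j ∈ Finset.range (n / r n),
          standardized P X r f.1 n (segment X n (j * r n) (r n) ω)
            * standardized P X r g.1 n (segment X n (j * r n) (r n) ω)
        + ∑ j ∈ Finset.range (n / r n),
          standardized P X r g.1 n (segment X n (j * r n) (r n) ω) ^ 2 := by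
    rw [Finset.mul_sum, ← Finset.sum_add_distrib, ← Finset.sum_add_distrib]
    exact Finset.sum_congr rfl fun j _ => by ring
  rw [e] at h1
  rw [abs_lt] at h1 h2 h3
  rcases le_abs'.1 hω with h | h <;> linarith

/-- Given the data, the multiplier process is distributed as a weighted sum of multipliers. -/
lemma condDistrib_multiplierProcess (hX : ∀ n i : ℕ, i < n → Measurable (X n i))
    (hs : RowwiseStationary P X) {ξ : ℕ → Ω → ℝ} (hξ : IsMultiplier P X ξ) {l : ℕ}
    {f : Fin l → EUnion d → ℝ} (hf : ∀ k, Measurable (f k)) (n : ℕ) :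
    ∀ᵐ ω ∂P, condDistrib (fun ω' (k : Fin l) => multiplierProcess P X r ξ n (f k) ω')
        (fun ω' (i : Fin n) => X n i ω') P (fun i : Fin n => X n i ω)
      = P.map fun ω' k => ∑ j ∈ Finset.range (n / r n),
        ξ j ω' * standardized P X r (f k) n (segment X n (j * r n) (r n) ω) := by
  have hrow : Measurable fun ω' (i : Fin n) => X n i ω' :=
    measurable_pi_lambda _ fun i => hX n i i.2
  have hind : IndepFun (fun ω' (i : Fin n) => X n i ω') (fun ω' j => ξ j ω') P :=
    hξ.indep_array.comp
      (φ := fun (x : (Σ n : ℕ, Fin n) → Fin d → ℝ) (i : Fin n) => x ⟨n, i⟩) (ψ := id)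
      (measurable_pi_lambda _ fun i => measurable_pi_apply _) measurable_id
  -- The process as a measurable function of the row and the multipliers. The default value 0 is
  -- never used, as every block lies within the row.
  let Φ : (Fin n → Fin d → ℝ) × (ℕ → ℝ) → (Fin l → ℝ) := fun p k =>
    ∑ j ∈ Finset.range (n / r n), p.2 j * standardized P X r (f k) n fun a =>
      if h : j * r n + a < n then p.1 ⟨_, h⟩ else 0
  have hΦ : Measurable Φ := by
    refine measurable_pi_lambda _ fun k => Finset.measurable_sum _ fun j _ => ?_
    refine ((measurable_pi_apply j).comp measurable_snd).mul
      ((measurable_standardized (hf k) n).comp (measurable_pi_lambda _ fun a => ?_))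
    by_cases h : j * r n + a < n
    · simp only [h, dite_true]
      exact (measurable_pi_apply _).comp measurable_fst
    · simp only [h, dite_false]
      exact measurable_const
  have hΦe : ∀ ω ω', Φ ((fun i : Fin n => X n i ω), fun j => ξ j ω') = fun k =>
      ∑ j ∈ Finset.range (n / r n),
        ξ j ω' * standardized P X r (f k) n (segment X n (j * r n) (r n) ω) := by
    intro ω ω'
    refine funext fun k => Finset.sum_congr rfl fun j hj => ?_
    have hj := mul_add_le_of_lt_div (Finset.mem_range.1 hj)
    congr 2
    refine funext fun a => ?_
    have : j * r n + a < n := by have := a.2; omega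
    simp only [this, dite_true, segment]
  have key := condDistrib_comp_prodMk_of_indepFun hrow
    (measurable_pi_lambda _ fun j => hξ.measurable j) hind hΦ
  have hZ : (fun ω' (k : Fin l) => multiplierProcess P X r ξ n (f k) ω')
      = fun ω' => Φ ((fun i : Fin n => X n i ω'), fun j => ξ j ω') := by
    funext ω' k
    rw [hΦe, multiplierProcess_eq_sum_standardized hX hs ξ (hf k)]
  rw [hZ]
  filter_upwards [key] with ω hω
  rw [hω]
  simp_rw [hΦe]

end Convergence

end ClusterBootstrap

/-! ### Proof of the theorem. -/

open ClusterBootstrap in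
theorem theorem2p1 {Ω : Type*} [MeasurableSpace Ω] (P : Measure Ω) [IsProbabilityMeasure P]
    {d : ℕ} (X : ℕ → ℕ → Ω → (Fin d → ℝ)) (hX : ∀ n i : ℕ, i < n → Measurable (X n i))
    (r ℓ : ℕ → ℕ) (F : Set (EUnion d → ℝ)) (hF : ∀ f ∈ F, IsClusterFunctional f)
    (c : F → F → ℝ) (ξ : ℕ → Ω → ℝ) (hξ : IsMultiplier P X ξ)
    (hB1 : CondB1 P X r ℓ) (hB2 : CondB2 P X r ℓ) (hC1 : CondC1 P X r ℓ F)
    (hC2 : CondC2 P X r F) (hC3 : CondC3 P X r F c) :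
    -- `c` is a covariance function, so that the Gaussian process `Z` exists
    (∀ (l : ℕ) (f : Fin l → F), (Matrix.of fun i j => c (f i) (f j)).PosSemidef) ∧
    -- conditional convergence of the finite-dimensional distributions
    ∀ {Ω' : Type*} [MeasurableSpace Ω'] (P' : Measure Ω') [IsProbabilityMeasure P']
      (Z : F → Ω' → ℝ), IsCentredGaussianProcess P' Z c →
      ∀ (l : ℕ) (f : Fin l → F),
        TendstoInMeasure P
          (fun (n : ℕ) (ω : Ω) =>
            dBL (condDistrib (fun ω' (k : Fin l) => multiplierProcess P X r ξ n (f k).1 ω')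
                (fun ω' (i : Fin n) => X n i ω') P (fun i : Fin n => X n i ω))
              (P'.map fun ω' (k : Fin l) => Z (f k) ω'))
          atTop (fun _ => 0) := by
  refine ⟨fun l f => posSemidef_of_tendsto_cov hC2 hC3 f, ?_⟩
  intro Ω' _ P' _ Z hZ l f
  rw [tendstoInMeasure_iff_measureReal_dist]
  intro ε hε
  have hZm : AEMeasurable (fun ω' (k : Fin l) => Z (f k) ω') P' :=
    aemeasurable_pi_lambda _ fun k => hZ.gaussian.aemeasurable _
  have hprob := Measure.isProbabilityMeasure_map hZm
  have hξ1 : P[ξ 0 ^ 2] = 1 := by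
    rw [← hξ.variance_one, variance_of_integral_eq_zero hξ.memLp.aemeasurable hξ.mean_zero]
    rfl
  obtain ⟨δ, hδ, hdet⟩ := exists_forall_dBL_weighted_sum_lt hξ.measurable hξ.iIndep
    hξ.identDistrib hξ.mean_zero hξ1 (fun k k' => c (f k) (f k'))
    (P'.map fun ω' (k : Fin l) => Z (f k) ω') (hZ.integral_exp f) hε
  have hcov := tendsto_finsetSum Finset.univ fun (p : Fin l × Fin l) _ =>
    tendsto_measureReal_sum_mul_standardized hX hF hB1 hB2 hC2 hC3 (f p.1) (f p.2) hδ
  have hmax := tendsto_finsetSum Finset.univ fun (k : Fin l) _ =>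
    tendsto_measureReal_exists_lt_abs_blocks (P := P) hX hB1.stationary
      (fun n => measurable_standardized (P := P) (X := X) (r := r)
        (hF (f k).1 (f k).2).measurable n)
      ((eventually_memLp_standardized hC2 (f k)).mono fun n hn => hn.integrable_sq) hδ
      (tendsto_mul_setIntegral_standardized hB1 hC2 (f k) hδ)
  have hadd := hcov.add hmax
  simp only [Finset.sum_const_zero, add_zero] at hadd
  -- Up to a null set, distance at least `ε` forces some sum of products to miss its limit by at
  -- least `δ`, or some weight to exceed `δ`. The null set arises because the conditional law is
  -- identified only almost surely.
  refine squeeze_zero (fun n => measureReal_nonneg) (fun n => ?_) hadd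
  refine le_trans ?_ ((measureReal_union_le _ _).trans (add_le_add
    (measureReal_biUnion_finset_le Finset.univ _) (measureReal_biUnion_finset_le Finset.univ _)))
  refine ENNReal.toReal_mono (measure_ne_top _ _) (measure_mono_ae ?_)
  filter_upwards [condDistrib_multiplierProcess (r := r) hX hB1.stationary hξ
    (fun k => (hF (f k).1 (f k).2).measurable) n] with ω hω hmem
  have hmem : ε ≤ dist (dBL _ _) 0 := hmem
  rw [hω, Real.dist_eq, sub_zero, abs_of_nonneg (dBL_nonneg _ _)] at hmem
  show ω ∈ (_ ∪ _ : Set Ω)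
  by_contra hcon
  simp only [Set.mem_union, Set.mem_iUnion, Finset.mem_univ, exists_prop, true_and,
    Set.mem_ofPred_eq, not_or, not_exists, not_and, not_lt, not_le] at hcon
  exact absurd (hdet (n / r n)
    (fun j k => standardized P X r (f k).1 n (segment X n (j * r n) (r n) ω))
    (fun k k' => (hcon.1 (k, k')).le) (fun j hj k => hcon.2 k j hj)) (not_lt.2 hmem)
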